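/- Consider the perturbed NLS equation $$ i q_t = q_{\zeta\zeta} + 2\,[\,|q|^2-\omega^2\,]\,q + i\epsilon\,[\,q_{\zeta\zeta}-\alpha q+\beta\,],\qquad q(t,\zeta+2\pi)=q(t,\zeta),\quad q(t,-\zeta)=q(t,\zeta), $$ with $\epsilon,\alpha,\beta>0$ and $\omega\in(\tfrac12,1)$. Let $Q_\epsilon=\sqrt I e^{i\theta}$ be the spatially uniform stationary solution on the branch $I=\omega^2-\epsilon\frac{1}{2\omega}\sqrt{\beta^2-\alpha^2\omega^2}+\cdots$, i.e. $I$ is the largest solution of $2\sqrt I(\omega^2-I)=\epsilon\sqrt{\beta^2-\alpha^2 I}$ with $I>0$, $\alpha\sqrt I<\beta$, and $\cos\theta=\alpha\sqrt I/\beta$, $\theta\in(0,\frac\pi2)$. The eigenvalues at $Q_\epsilon$ are $$ \lambda_n^{\pm}=-\epsilon[\alpha+n^2]\pm 2\sqrt{\Big(\frac{n^2}{2}+\omega^2-I\Big)\Big(3I-\omega^2-\frac{n^2}{2}\Big)},\qquad n=0,1,2,\dots $$ Put $\Lambda_n=\lambda_n^+$ for $n\ge 0$ and $\Lambda_n=\lambda^-_{-n-1}$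 for $n<0$. We say that the equation has a symmetric pair of Silnikov homoclinic orbits at $(\alpha,\beta,\omega)$ if - $\lambda_0^+,\lambda_1^+$ are the only eigenvalues with positive real part, all others have negative real part, $\mathrm{Re}\,\lambda_0^+<\mathrm{Re}\,\lambda_1^+$, $|\mathrm{Re}\,\lambda_2^+|=|\mathrm{Re}\,\lambda_2^-|$ is strictly smaller than $|\mathrm{Re}\,\lambda|$ for every other eigenvalue $\lambda$ with negative real part, and $|\mathrm{Re}\,\lambda_2^+|<\mathrm{Re}\,\lambda_0^+$; and - there is a nonconstant classical (jointly $C^2$) solution $q(t,\zeta)$, $t\in\mathbb R$, converging to $Q_\epsilon$ in $H^1$ as $t\to\pm\infty$, such that $q(t,\zeta)$ and $q(t,\zeta+\pi)$ are two different homoclinic orbits (not time translates of each other). Let $$\kappa(\omega)=\frac{3\,[(1+\sigma^2)\arctan\sigma-\sigma]}{2\sigma^3},\qquad \sigma=\sqrt{4\omega^2-1},$$ which gives the leading order representation $\alpha=1/\kappa(\omega)$ of the codimension 1 surface of parameters of such orbits. Let $D$ be a nonempty connected open set of points $(\beta,\omega)$ whose closure is a compact subset of $\{(\beta,\omega):\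 \tfrac12<\omega<1,\ \kappa(\omega)>0,\ \omega/\kappa(\omega)<\beta\}$. **Lemma (nonresonance condition of Siegel type).** There are $\epsilon_0>0$ and $\delta>0$, depending only on $D$, such that the following holds for every fixed $\epsilon\in(0,\epsilon_0)$. Let $$E_\epsilon=\{(\alpha,\beta,\omega):\ (\beta,\omega)\in D,\ \alpha=A(\beta,\omega)\}$$ be a codimension 1 surface, $A$ real-analytic on $D$ with the approximate representation $|A(\beta,\omega)-1/\kappa(\omega)|<\delta$ on $D$, lying in the region $\alpha>0$, $\beta>0$, $\omega\in(\frac12,1)$, $\alpha\omega<\beta$, such that at each of its points the equation has a symmetric pair of Silnikov homoclinic orbits. Then for almost every $(\alpha,\beta,\omega)\in E_\epsilon$ (with respect to the two-dimensional Hausdorff measure) there exists a natural number $s$ such that for any integer $n\ge 2$, $$\Big|\Lambda_n-\sum_{j=1}^r\Lambda_{l_j}\Big|\ \ge\ \frac1{r^s}$$ for all $r=2,3,\dots,n$ and all $l_1,\dots,l_r\in\mathbb Z$. -/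

import Mathlib

open MeasureTheory Filter Topology

noncomputable section

namespace PNLS

/-- `q` is a classical solution, defined for all times `t`, of the singularly perturbed NLS equation
`i q_t = q_ζζ + 2 (|q|² - ω²) q + i ε (q_ζζ - α q + β)`,
even and `2π`-periodic in the space variable `ζ`. -/
structure IsEntireSolution (ε α β ω : ℝ) (q : ℝ → ℝ → ℂ) : Prop where
  smooth : ContDiff ℝ 2 (fun x : ℝ × ℝ => q x.1 x.2)
  periodic : ∀ t ζ, q t (ζ + 2 * Real.pi) = q t ζ
  even : ∀ t ζ, q t (-ζ) = q t ζ
  eqn : ∀ t ζ, Complex.I * deriv (fun τ => q τ ζ) t =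
    deriv (deriv (q t)) ζ + 2 * ((‖q t ζ‖ : ℂ) ^ 2 - (ω : ℂ) ^ 2) * q t ζ
      + Complex.I * ε * (deriv (deriv (q t)) ζ - α * q t ζ + β)

/-- The squared moduli `I` of the spatially uniform stationary solutions `√I e^{iθ}` with
`θ ∈ (0, π/2)`. Substituting in the equation gives `cos θ = α √I / β` and
`ε β sin θ = 2 √I (ω² - I)`. -/
def stationaryIntensities (ε α β ω : ℝ) : Set ℝ :=
  {J | 0 < J ∧ α * √J < β ∧ 2 * √J * (ω ^ 2 - J) = ε * √(β ^ 2 - α ^ 2 * J)}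

/-- The squared modulus `I` of the saddle `Q_ε`: the branch
`I = ω² - ε √(β² - α² ω²) / (2 ω) + ⋯` that emanates from `ω²` is the largest one. -/
def saddleIntensity (ε α β ω : ℝ) : ℝ := sSup (stationaryIntensities ε α β ω)

/-- The saddle `Q_ε = √I e^{iθ}`, `cos θ = α √I / β`. -/
def saddle (ε α β ω : ℝ) : ℂ :=
  let J := saddleIntensity ε α β ω
  (√J : ℂ) * Complex.exp (Complex.I * (Real.arccos (α * √J / β) : ℂ))

/-- The (real) radicand `(n²/2 + ω² - I) (3 I - ω² - n²/2)`. -/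
def radicand (ε α β ω : ℝ) (n : ℕ) : ℝ :=
  let J := saddleIntensity ε α β ω
  ((n : ℝ) ^ 2 / 2 + ω ^ 2 - J) * (3 * J - ω ^ 2 - (n : ℝ) ^ 2 / 2)

/-- The eigenvalue `λ_n^+` of the linearization at the saddle; the complex power `1/2` is the
principal square root, so it is `i √|x|` at a negative real `x`. -/
def eigPlus (ε α β ω : ℝ) (n : ℕ) : ℂ :=
  -(ε : ℂ) * ((α : ℂ) + (n : ℂ) ^ 2) + 2 * ((radicand ε α β ω n : ℝ) : ℂ) ^ (1 / 2 : ℂ)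

/-- The eigenvalue `λ_n^-` of the linearization at the saddle. -/
def eigMinus (ε α β ω : ℝ) (n : ℕ) : ℂ :=
  -(ε : ℂ) * ((α : ℂ) + (n : ℂ) ^ 2) - 2 * ((radicand ε α β ω n : ℝ) : ℂ) ^ (1 / 2 : ℂ)

/-- All eigenvalues in one sequence indexed by `ℤ`: `Λ_n = λ_n^+` for `n ≥ 0` and
`Λ_n = λ_{-n-1}^-` for `n < 0`. -/
def eig (ε α β ω : ℝ) (n : ℤ) : ℂ :=
  if 0 ≤ n then eigPlus ε α β ω n.toNat else eigMinus ε α β ω (-n - 1).toNat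

/-- The nonresonance condition of Siegel type. -/
def SiegelNonresonant (ε α β ω : ℝ) : Prop :=
  ∃ s : ℕ, ∀ n : ℤ, 2 ≤ n → ∀ r : ℕ, 2 ≤ r → (r : ℤ) ≤ n → ∀ l : Fin r → ℤ,
    ‖eig ε α β ω n - ∑ j, eig ε α β ω (l j)‖ ≥ 1 / (r : ℝ) ^ s

/-- The saddle `Q_ε` exists and has the eigenvalue configuration of a Silnikov saddle: only
`λ_0^+` and `λ_1^+` have positive real parts, `Re λ_0^+ < Re λ_1^+`; among the others
`|Re λ_2^±|` is the smallest; and `|Re λ_2^+| < Re λ_0^+`. -/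
structure IsSilnikovSaddle (ε α β ω : ℝ) : Prop where
  isGreatest : IsGreatest (stationaryIntensities ε α β ω) (saddleIntensity ε α β ω)
  unstable_pos : 0 < (eigPlus ε α β ω 0).re
  unstable_lt : (eigPlus ε α β ω 0).re < (eigPlus ε α β ω 1).re
  stable_plus : ∀ n : ℕ, 2 ≤ n → (eigPlus ε α β ω n).re < 0
  stable_minus : ∀ n : ℕ, (eigMinus ε α β ω n).re < 0
  leading_eq : (eigPlus ε α β ω 2).re = (eigMinus ε α β ω 2).re
  leading_plus : ∀ n : ℕ, 3 ≤ n → |(eigPlus ε α β ω 2).re| < |(eigPlus ε α β ω n).re|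
  leading_minus : ∀ n : ℕ, n ≠ 2 → |(eigPlus ε α β ω 2).re| < |(eigMinus ε α β ω n).re|
  gap : |(eigPlus ε α β ω 2).re| < (eigPlus ε α β ω 0).re

/-- Squared distance in `H¹` of one period between the function `u` and the constant `c`. -/
def sqDistH1 (u : ℝ → ℂ) (c : ℂ) : ℝ :=
  ∫ ζ in (0 : ℝ)..(2 * Real.pi), (‖u ζ - c‖ ^ 2 + ‖deriv u ζ‖ ^ 2)

/-- `q` is a homoclinic orbit asymptotic to the saddle `Q_ε` (and not the saddle itself). -/
structure IsHomoclinic (ε α β ω : ℝ) (q : ℝ → ℝ → ℂ) : Prop where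
  solution : IsEntireSolution ε α β ω q
  backward : Tendsto (fun t => sqDistH1 (q t) (saddle ε α β ω)) atBot (𝓝 0)
  forward : Tendsto (fun t => sqDistH1 (q t) (saddle ε α β ω)) atTop (𝓝 0)
  nontrivial : ∃ t ζ, q t ζ ≠ saddle ε α β ω

/-- At the parameters `(α, β, ω)` the perturbed NLS equation possesses a symmetric pair of Silnikov
homoclinic orbits `q(t, ζ)` and `q(t, ζ + π)` asymptotic to `Q_ε`; the two orbits are different. -/
def HasSilnikovPair (ε α β ω : ℝ) : Prop :=
  IsSilnikovSaddle ε α β ω ∧ ∃ q : ℝ → ℝ → ℂ, IsHomoclinic ε α β ω q ∧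
    IsHomoclinic ε α β ω (fun t ζ => q t (ζ + Real.pi)) ∧
    ∀ τ : ℝ, ∃ t ζ, q (t + τ) ζ ≠ q t (ζ + Real.pi)

/-- The function `κ(ω)` of the leading order representation `α = 1 / κ(ω)`. With
`σ = √(4 ω² - 1)`, the growth rate of the unstable mode of the unperturbed equation,
`κ = 3 ((1 + σ²) arctan σ - σ) / (2 σ³)`. It is the ratio
`(∬ Im(h̄_t h) dζ dt + 2 π ω² Δγ) / ∬ Im(h̄_t h_ζζ) dζ dt`
of the Melnikov integrals along the homoclinic orbit
`h = ω (cos 2p - i sin 2p tanh σt - sin p sech σt cos ζ) / (1 + sin p sech σt cos ζ)`,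
`p = arctan σ`, of the unperturbed equation, `Δγ = -4 p` being its phase shift. -/
def kappa (ω : ℝ) : ℝ :=
  let σ := √(4 * ω ^ 2 - 1)
  3 * ((1 + σ ^ 2) * Real.arctan σ - σ) / (2 * σ ^ 3)

/-- The region of the `(β, ω)`-plane above which the leading order surface `α = 1 / κ(ω)` satisfies
`α > 0`, `ω ∈ (1/2, 1)` and `α ω < β`. -/
def baseRegion : Set (ℝ × ℝ) :=
  {x | 1 / 2 < x.2 ∧ x.2 < 1 ∧ 0 < kappa x.2 ∧ x.2 / kappa x.2 < x.1}

/-- `E` is a real-analytic codimension 1 surface `α = A(β, ω)`, `(β, ω) ∈ D`, in the space of the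
parameters `(α, β, ω)`, approximately represented (up to `δ`) by `α = 1 / κ(ω)`, on which
symmetric pairs of Silnikov homoclinic orbits are supported. -/
structure IsSilnikovSurface (ε δ : ℝ) (D : Set (ℝ × ℝ)) (E : Set (ℝ × ℝ × ℝ)) : Prop where
  surface : ∃ A : ℝ × ℝ → ℝ, AnalyticOnNhd ℝ A D ∧
    (∀ x ∈ D, |A x - 1 / kappa x.2| < δ) ∧ E = (fun x => (A x, x)) '' D
  region : ∀ α β ω : ℝ, (α, β, ω) ∈ E →
    0 < α ∧ 0 < β ∧ 1 / 2 < ω ∧ ω < 1 ∧ α * ω < β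
  support : ∀ α β ω : ℝ, (α, β, ω) ∈ E → HasSilnikovPair ε α β ω

end PNLS

end

/-!
The real parts of the small divisors already satisfy the nonresonance condition almost everywhere.
For `n ≥ 2` the radicand of `λ_n^±` is negative, so `Re λ_n^± = -ε (α + n²)`, and the real part of
`Λ_n - ∑ Λ_{l_j}` is an integer combination of `ε`, `ε α`, `2 √R₀` and `2 √R₁`, where `R₀`, `R₁` are
the radicands of the two real pairs. The coefficient of `ε α` is `r - 1 ≥ 1`, those of the square
roots are at most `r` in modulus, and if that of `ε` is not `O(r)` then the divisor exceeds `1`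
(`IsSilnikovSaddle.siegelNonresonant`). So it suffices that at almost every parameter these four
functions satisfy a Diophantine inequality, with constants depending on the point.

This holds for any linearly independent analytic functions `F` on a connected open set
(`ae_diophantine`). No nontrivial combination `v · F` vanishes near a point, so some pure directional
derivative of it is nonzero there; by compactness of the unit sphere of coefficients, finitely many
directions and orders suffice. A function whose `k`-th derivative is at least `c` is smaller than
`c h ^ k` only on a set of measure `O(h)` (`volume_abs_lt_le`), and integration over segments gives
the same for `v · F`, uniformly in `v` (`uniformSublevel_of_linearIndependent`). Borel-Cantelli
concludes.

Two properties of the four functions are needed.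

* Analyticity: the saddle intensity is a root of a cubic at which the derivative is negative, which
  is exactly `λ_0^+ > 0`. A cubic with positive leading coefficient has at most one such root, so the
  analytic implicit function theorem applies (`analyticOnNhd_saddleIntensity`).
* Linear independence: as `ε → 0` and `A → 1 / κ`, the functions `1`, `α`, `√R₀ / √ε`, `√R₁` tend
  pointwise to `1`, `1 / κ`, a function that is strictly increasing in `β`, and `σ / 2`. The limits
  are independent, because `arctan σ` is not a rational function of `σ`
  (`linearIndependent_scaledBasis`). Independence is an open condition
  (`exists_independent_of_tendsto`), which determines `ε₀` and `δ`.

Finally, the parametrization of the surface is locally Lipschitz and therefore maps Lebesgue null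
sets to null sets of the two-dimensional Hausdorff measure.
-/

namespace PNLS

/-! ### Sublevel sets of functions with a large derivative -/

/-- Sublevel estimate in one variable: `g i` is the `i`-th derivative of `g 0`, and if the `k`-th
one is at least `c` on an interval, then `|g 0| < c h ^ k` only on a set of measure `O(h)`.
By induction: `|g k| < c h` on a set of diameter at most `2 h`, and on each of the two remaining
intervals the claim for `k` applies with `c h` in place of `c`. -/
theorem volume_abs_lt_le (k : ℕ) (g : ℕ → ℝ → ℝ) (I : Set ℝ) (hI : I.OrdConnected)
    (hg : ∀ i < k, ∀ s ∈ I, HasDerivAt (g i) (g (i + 1) s) s) {c h : ℝ} (hc : 0 < c) (hh : 0 < h)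
    (hk : ∀ s ∈ I, c ≤ g k s) :
    volume {s ∈ I | |g 0 s| < c * h ^ k} ≤ ENNReal.ofReal ((2 ^ (k + 1) - 2) * h) := by
  induction k generalizing g I c with
  | zero =>
    have : {s ∈ I | |g 0 s| < c * h ^ 0} = ∅ := by
      ext s
      simp only [pow_zero, mul_one, Set.mem_ofPred_eq, Set.mem_empty_iff_false, iff_false, not_and,
        not_lt]
      exact fun hs => (hk s hs).trans (le_abs_self _)
    rw [this, measure_empty]
    exact zero_le
  | succ k ih =>
    have hd : ∀ s ∈ I, HasDerivAt (g k) (g (k + 1) s) s := hg k (Nat.lt_succ_self k)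
    have hgrow : ∀ x ∈ I, ∀ y ∈ I, x ≤ y → c * (y - x) ≤ g k y - g k x := by
      refine hI.convex.mul_sub_le_image_sub_of_le_deriv
        (fun s hs => (hd s hs).continuousAt.continuousWithinAt)
        (fun s hs => (hd s (interior_subset hs)).differentiableAt.differentiableWithinAt)
        (fun s hs => ?_)
      rw [(hd s (interior_subset hs)).deriv]
      exact hk s (interior_subset hs)
    have hmono : MonotoneOn (g k) I := fun x hx y hy hxy => by
      nlinarith [hgrow x hx y hy hxy, mul_nonneg hc.le (sub_nonneg.2 hxy)]
    have hch : 0 < c * h := mul_pos hc hh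
    have hpow : c * h ^ (k + 1) = c * h * h ^ k := by ring
    have hup := ih g {s ∈ I | c * h ≤ g k s}
      ⟨fun x hx y hy z hz => ⟨hI.out hx.1 hy.1 hz,
        hx.2.trans (hmono hx.1 (hI.out hx.1 hy.1 hz) hz.1)⟩⟩
      (fun i hi s hs => hg i (hi.trans (Nat.lt_succ_self k)) s hs.1) hch (fun s hs => hs.2)
    have hlow := ih (fun i s => -g i s) {s ∈ I | g k s ≤ -(c * h)}
      ⟨fun x hx y hy z hz => ⟨hI.out hx.1 hy.1 hz,
        (hmono (hI.out hx.1 hy.1 hz) hy.1 hz.2).trans hy.2⟩⟩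
      (fun i hi s hs => (hg i (hi.trans (Nat.lt_succ_self k)) s hs.1).neg) hch
      (fun s hs => le_neg_of_le_neg hs.2)
    have hmid : volume {s ∈ I | |g k s| < c * h} ≤ ENNReal.ofReal (2 * h) := by
      refine (Real.volume_le_diam _).trans (Metric.ediam_le ?_)
      have key : ∀ x ∈ {s ∈ I | |g k s| < c * h}, ∀ y ∈ {s ∈ I | |g k s| < c * h}, x ≤ y →
          y - x ≤ 2 * h := by
        intro x hx y hy hxy
        have h1 := hgrow x hx.1 y hy.1 hxy
        have h2 := (abs_lt.1 hx.2).1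
        have h3 := (abs_lt.1 hy.2).2
        exact le_of_mul_le_mul_left (by linarith : c * (y - x) ≤ c * (2 * h)) hc
      intro x hx y hy
      rw [edist_dist]
      refine ENNReal.ofReal_le_ofReal ?_
      rw [Real.dist_eq]
      rcases le_total x y with hxy | hxy
      · rw [abs_sub_comm, abs_of_nonneg (sub_nonneg.2 hxy)]
        exact key x hx y hy hxy
      · rw [abs_of_nonneg (sub_nonneg.2 hxy)]
        exact key y hy x hx hxy
    have hsub : {s ∈ I | |g 0 s| < c * h ^ (k + 1)} ⊆ {s ∈ I | |g k s| < c * h} ∪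
        ({s ∈ {s ∈ I | c * h ≤ g k s} | |g 0 s| < c * h * h ^ k} ∪
          {s ∈ {s ∈ I | g k s ≤ -(c * h)} | |-g 0 s| < c * h * h ^ k}) := by
      rintro s ⟨hs, hs0⟩
      rw [hpow] at hs0
      by_cases h1 : |g k s| < c * h
      · exact Or.inl ⟨hs, h1⟩
      · rcases le_abs.1 (not_lt.1 h1) with h2 | h2
        · exact Or.inr (Or.inl ⟨⟨hs, h2⟩, hs0⟩)
        · exact Or.inr (Or.inr ⟨⟨hs, le_neg_of_le_neg h2⟩, by rwa [abs_neg]⟩)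
    have hpos : (0 : ℝ) ≤ (2 ^ (k + 1) - 2) * h := by
      have : (1 : ℝ) ≤ 2 ^ k := one_le_pow₀ (by norm_num)
      refine mul_nonneg ?_ hh.le
      rw [pow_succ]
      linarith
    calc volume {s ∈ I | |g 0 s| < c * h ^ (k + 1)}
        ≤ ENNReal.ofReal (2 * h) + (ENNReal.ofReal ((2 ^ (k + 1) - 2) * h) +
            ENNReal.ofReal ((2 ^ (k + 1) - 2) * h)) :=
          (measure_mono hsub).trans ((measure_union_le _ _).trans
            (add_le_add hmid ((measure_union_le _ _).trans (add_le_add hup hlow))))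
      _ = ENNReal.ofReal ((2 ^ (k + 1 + 1) - 2) * h) := by
          rw [← ENNReal.ofReal_add hpos hpos, ← ENNReal.ofReal_add (by positivity) (by positivity)]
          congr 1
          ring

/-- If every segment of length `τ` in the direction `u` meets `S` in a set of measure at most `B`,
then `S` has measure `O(B)`. No coordinates adapted to `u` are needed: by translation invariance
`τ μ(S)` is the average over `s ∈ [0, τ]` of the measures of the translates `S - s u`, and Tonelli
gives the bound. -/
theorem measure_le_of_segments {E : Type*} [NormedAddCommGroup E] [NormedSpace ℝ E]
    [MeasurableSpace E] [BorelSpace E] [FiniteDimensional ℝ E] (μ : Measure E)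
    [μ.IsAddHaarMeasure] {x₀ u : E} {ρ τ : ℝ} (hτu : τ * ‖u‖ ≤ ρ) {S : Set E} (hS : MeasurableSet S)
    (hSρ : S ⊆ Metric.ball x₀ ρ) {B : ENNReal}
    (hB : ∀ y ∈ Metric.ball x₀ (2 * ρ), volume {s ∈ Set.Icc 0 τ | y + s • u ∈ S} ≤ B) :
    ENNReal.ofReal τ * μ S ≤ B * μ (Metric.ball x₀ (2 * ρ)) := by
  have : ProperSpace E := FiniteDimensional.proper_real E
  set T : Set (E × ℝ) := {p | p.1 ∈ Metric.ball x₀ (2 * ρ) ∧ p.2 ∈ Set.Icc 0 τ ∧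
    p.1 + p.2 • u ∈ S} with hT
  have hTm : MeasurableSet T := by
    refine (measurable_fst Metric.isOpen_ball.measurableSet).inter
      ((measurable_snd measurableSet_Icc).inter ?_)
    exact (by fun_prop : Continuous fun p : E × ℝ => p.1 + p.2 • u).measurable hS
  have hfib : ∀ s ∈ Set.Icc 0 τ, μ ((fun y => (y, s)) ⁻¹' T) = μ S := by
    intro s hs
    rw [← measure_preimage_add_right μ (s • u) S]
    congr 1
    ext y
    simp only [hT, Set.mem_preimage, Set.mem_ofPred_eq]
    refine ⟨fun h => h.2.2, fun h => ⟨?_, hs, h⟩⟩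
    have h1 := hSρ h
    rw [Metric.mem_ball, dist_eq_norm] at h1 ⊢
    have h2 : ‖s • u‖ ≤ ρ := by
      rw [norm_smul, Real.norm_of_nonneg hs.1]
      exact (mul_le_mul_of_nonneg_right hs.2 (norm_nonneg u)).trans hτu
    calc ‖y - x₀‖ = ‖(y + s • u - x₀) - s • u‖ := by congr 1; abel
      _ ≤ ‖y + s • u - x₀‖ + ‖s • u‖ := norm_sub_le _ _
      _ < 2 * ρ := by linarith
  calc ENNReal.ofReal τ * μ S = ∫⁻ s in Set.Icc 0 τ, μ S := by
        rw [setLIntegral_const, Real.volume_Icc, sub_zero, mul_comm]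
    _ = ∫⁻ s in Set.Icc 0 τ, μ ((fun y => (y, s)) ⁻¹' T) :=
        setLIntegral_congr_fun measurableSet_Icc fun s hs => (hfib s hs).symm
    _ ≤ ∫⁻ s, μ ((fun y => (y, s)) ⁻¹' T) := setLIntegral_le_lintegral _ _
    _ = (μ.prod volume) T := (Measure.prod_apply_symm hTm).symm
    _ = ∫⁻ y, volume (Prod.mk y ⁻¹' T) ∂μ := Measure.prod_apply hTm
    _ ≤ ∫⁻ y, (Metric.ball x₀ (2 * ρ)).indicator (fun _ => B) y ∂μ := by
        refine lintegral_mono fun y => ?_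
        by_cases hy : y ∈ Metric.ball x₀ (2 * ρ)
        · rw [Set.indicator_of_mem hy]
          exact (measure_mono fun s hs => hs.2).trans (hB y hy)
        · have : Prod.mk y ⁻¹' T = ∅ := by
            ext s
            simp only [hT, Set.mem_preimage, Set.mem_ofPred_eq, Set.mem_empty_iff_false, iff_false]
            exact fun h => hy h.1
          rw [this, measure_empty]
          exact zero_le
    _ = B * μ (Metric.ball x₀ (2 * ρ)) := by
        rw [lintegral_indicator Metric.isOpen_ball.measurableSet, setLIntegral_const]

/-! ### Iterated directional derivatives of analytic functions -/

section
variable {E : Type*} [NormedAddCommGroup E] [NormedSpace ℝ E]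

/-- The derivative of `f` in the direction `u`, as an operator on functions, so that it can be
iterated. -/
noncomputable def dirDeriv (u : E) (f : E → ℝ) (y : E) : ℝ := fderiv ℝ f y u

theorem analyticOnNhd_iterate_dirDeriv {U : Set E} {f : E → ℝ} (hf : AnalyticOnNhd ℝ f U) (u : E)
    (k : ℕ) : AnalyticOnNhd ℝ ((dirDeriv u)^[k] f) U := by
  induction k with
  | zero => exact hf
  | succ k ih =>
    rw [Function.iterate_succ_apply']
    intro y hy
    exact ((ContinuousLinearMap.apply ℝ ℝ u).analyticAt _).comp (ih y hy).fderiv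

theorem hasDerivAt_iterate_dirDeriv {U : Set E} {f : E → ℝ} (hf : AnalyticOnNhd ℝ f U) (u : E)
    (k : ℕ) {y : E} {s : ℝ} (hs : y + s • u ∈ U) :
    HasDerivAt (fun s : ℝ => (dirDeriv u)^[k] f (y + s • u))
      ((dirDeriv u)^[k + 1] f (y + s • u)) s := by
  have hline : HasDerivAt (fun s : ℝ => y + s • u) u s := by
    simpa using ((hasDerivAt_id s).smul_const u).const_add y
  have := (analyticOnNhd_iterate_dirDeriv hf u k _ hs).differentiableAt.hasFDerivAt
  rw [Function.iterate_succ_apply']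
  exact this.comp_hasDerivAt s hline

theorem iterate_dirDeriv_sum {ι : Type*} [Fintype ι] {U : Set E} (hU : IsOpen U) {F : ι → E → ℝ}
    (hF : ∀ i, AnalyticOnNhd ℝ (F i) U) (v : ι → ℝ) (u : E) (k : ℕ) :
    ∀ y ∈ U, (dirDeriv u)^[k] (fun y => ∑ i, v i * F i y) y =
      ∑ i, v i * (dirDeriv u)^[k] (F i) y := by
  induction k with
  | zero => exact fun y _ => rfl
  | succ k ih =>
    intro y hy
    rw [Function.iterate_succ_apply', dirDeriv,
      (Filter.eventuallyEq_of_mem (hU.mem_nhds hy) ih : _ =ᶠ[𝓝 y] _).fderiv_eq]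
    have hd : ∀ i ∈ Finset.univ, DifferentiableAt ℝ (fun y => v i * (dirDeriv u)^[k] (F i) y) y :=
      fun i _ => ((analyticOnNhd_iterate_dirDeriv (hF i) u k y hy).differentiableAt).const_mul _
    rw [fderiv_fun_sum hd, _root_.sum_apply]
    refine Finset.sum_congr rfl fun i _ => ?_
    rw [fderiv_const_mul (analyticOnNhd_iterate_dirDeriv (hF i) u k y hy).differentiableAt,
      Function.iterate_succ_apply']
    rfl

/-- An analytic function that does not vanish identically near a point has a pure directional
derivative of some order that does not vanish there. -/
theorem exists_iterate_dirDeriv_ne_zero {U : Set E} (hU : IsOpen U) {f : E → ℝ}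
    (hf : AnalyticOnNhd ℝ f U) {x₀ : E} (hx₀ : x₀ ∈ U) (hne : ¬ f =ᶠ[𝓝 x₀] 0) :
    ∃ u k, (dirDeriv u)^[k] f x₀ ≠ 0 := by
  by_contra! hall
  obtain ⟨ρ, hρ, hball⟩ := Metric.isOpen_iff.1 hU x₀ hx₀
  refine hne (Filter.eventuallyEq_of_mem (Metric.ball_mem_nhds x₀ hρ) fun y hy => ?_)
  set u := y - x₀
  set V : Set ℝ := {s | x₀ + s • u ∈ Metric.ball x₀ ρ}
  have hVo : IsOpen V :=
    Metric.isOpen_ball.preimage (by fun_prop : Continuous fun s : ℝ => x₀ + s • u)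
  have hVc : IsPreconnected V := by
    refine Convex.isPreconnected fun s hs t ht a b ha hb hab => ?_
    have := convex_ball x₀ ρ hs ht ha hb hab
    have e : a • (x₀ + s • u) + b • (x₀ + t • u) = x₀ + (a • s + b • t) • u := by
      rw [smul_add, smul_add, add_smul, smul_assoc, smul_assoc,
        add_add_add_comm, ← add_smul, hab, one_smul]
    rwa [e] at this
  have h0 : (0 : ℝ) ∈ V := by simpa [V] using hρ
  have h1 : (1 : ℝ) ∈ V := by simpa [V, u, dist_eq_norm] using hy
  have hφ : AnalyticOnNhd ℝ (fun s : ℝ => f (x₀ + s • u)) V := fun s hs =>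
    (hf _ (hball hs)).fun_comp (f := fun s : ℝ => x₀ + s • u) (by fun_prop)
  have hder : ∀ k, ∀ s ∈ V, iteratedDeriv k (fun s : ℝ => f (x₀ + s • u)) s =
      (dirDeriv u)^[k] f (x₀ + s • u) := by
    intro k
    induction k with
    | zero => intro s _; simp
    | succ k ih =>
      intro s hs
      rw [iteratedDeriv_succ, (Filter.eventuallyEq_of_mem (hVo.mem_nhds hs) ih :
        _ =ᶠ[𝓝 s] _).deriv_eq]
      exact (hasDerivAt_iterate_dirDeriv hf u k (hball hs)).deriv
  have htop : analyticOrderAt (fun s : ℝ => f (x₀ + s • u)) 0 = ⊤ := by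
    refine ENat.eq_top_iff_forall_ge.2 fun n => ?_
    rw [natCast_le_analyticOrderAt_iff_iteratedDeriv_eq_zero (hφ 0 h0)]
    intro i _
    rw [hder i 0 h0]
    simpa using hall u i
  have := hφ.eqOn_zero_of_preconnected_of_eventuallyEq_zero hVc h0 (analyticOrderAt_eq_top.1 htop) h1
  simpa [u] using this

/-! ### Sublevel sets of linear combinations of analytic functions -/

/-- `UniformSublevel μ F x₀ N`: near `x₀` the sublevel sets of the combinations `∑ i, v i * F i`
with `v ∈ N` are small, with constants that do not depend on `v`. -/
def UniformSublevel {X : Type*} [TopologicalSpace X] [MeasurableSpace X] {ι : Type*}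
    [Fintype ι] (μ : Measure X) (F : ι → X → ℝ) (x₀ : X) (N : Set (ι → ℝ)) : Prop :=
  ∃ V ∈ 𝓝 x₀, ∃ C : NNReal, ∃ k : ℕ, ∃ c : ℝ, 0 < c ∧ ∀ v ∈ N, ∀ h : ℝ, 0 < h → h ≤ 1 →
    μ {y ∈ V | |∑ i, v i * F i y| < c * h ^ k} ≤ C * ENNReal.ofReal h

section
variable {X : Type*} [TopologicalSpace X] [MeasurableSpace X] {ι : Type*} [Fintype ι]
  {μ : Measure X} {F : ι → X → ℝ} {x₀ : X}

theorem UniformSublevel.mono {M N : Set (ι → ℝ)} (h : UniformSublevel μ F x₀ N) (hMN : M ⊆ N) :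
    UniformSublevel μ F x₀ M := by
  obtain ⟨V, hV, C, k, c, hc, H⟩ := h
  exact ⟨V, hV, C, k, c, hc, fun v hv => H v (hMN hv)⟩

theorem UniformSublevel.union {M N : Set (ι → ℝ)} (hM : UniformSublevel μ F x₀ M)
    (hN : UniformSublevel μ F x₀ N) : UniformSublevel μ F x₀ (M ∪ N) := by
  obtain ⟨V, hV, C, k, c, hc, H⟩ := hM
  obtain ⟨V', hV', C', k', c', hc', H'⟩ := hN
  refine ⟨V ∩ V', inter_mem hV hV', C + C', k + k', min c c', lt_min hc hc', fun v hv h hh h1 => ?_⟩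
  rw [ENNReal.coe_add, add_mul]
  rcases hv with hv | hv
  · refine ((measure_mono fun y hy => ?_).trans (H v hv h hh h1)).trans le_self_add
    refine ⟨hy.1.1, hy.2.trans_le ?_⟩
    exact mul_le_mul (min_le_left _ _) (pow_le_pow_of_le_one hh.le h1 (Nat.le_add_right _ _))
      (pow_nonneg hh.le _) hc.le
  · refine ((measure_mono fun y hy => ?_).trans (H' v hv h hh h1)).trans le_add_self
    refine ⟨hy.1.2, hy.2.trans_le ?_⟩
    exact mul_le_mul (min_le_right _ _) (pow_le_pow_of_le_one hh.le h1 (Nat.le_add_left _ _))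
      (pow_nonneg hh.le _) hc'.le

end

section
variable [MeasurableSpace E] {ι : Type*} [Fintype ι] {μ : Measure E} {F : ι → E → ℝ} {x₀ : E}

/-- If a combination does not vanish identically near `x₀`, then it satisfies, together with all
nearby combinations, a sublevel estimate: some pure directional derivative stays away from zero. -/
theorem exists_nhds_uniformSublevel [BorelSpace E] [FiniteDimensional ℝ E] [μ.IsAddHaarMeasure]
    {U : Set E} (hU : IsOpen U) (hF : ∀ i, AnalyticOnNhd ℝ (F i) U) (hx₀ : x₀ ∈ U) {v₀ : ι → ℝ}
    (hv₀ : ¬ (fun y => ∑ i, v₀ i * F i y) =ᶠ[𝓝 x₀] 0) :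
    ∃ N ∈ 𝓝 v₀, UniformSublevel μ F x₀ N := by
  have : ProperSpace E := FiniteDimensional.proper_real E
  have hcomb : ∀ v : ι → ℝ, AnalyticOnNhd ℝ (fun y => ∑ i, v i * F i y) U := fun v y hy =>
    Finset.analyticAt_fun_sum _ fun i _ => analyticAt_const.mul (hF i y hy)
  obtain ⟨u, k, huk⟩ := exists_iterate_dirDeriv_ne_zero hU (hcomb v₀) hx₀ hv₀
  obtain ⟨σ, hσ, hσpos⟩ : ∃ σ : ℝ, |σ| = 1 ∧
      0 < σ * (dirDeriv u)^[k] (fun y => ∑ i, v₀ i * F i y) x₀ := by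
    rcases lt_or_gt_of_ne huk with h | h
    · exact ⟨-1, by simp, by linarith⟩
    · exact ⟨1, by simp, by linarith⟩
  rw [iterate_dirDeriv_sum hU hF v₀ u k x₀ hx₀] at hσpos
  set G : (ι → ℝ) × E → ℝ := fun p => σ * ∑ i, p.1 i * (dirDeriv u)^[k] (F i) p.2 with hG
  have hGc : ContinuousAt G (v₀, x₀) := by
    have : ∀ i, ContinuousAt (fun p : (ι → ℝ) × E => (dirDeriv u)^[k] (F i) p.2) (v₀, x₀) :=
      fun i => ContinuousAt.comp (f := Prod.snd)
        (analyticOnNhd_iterate_dirDeriv (hF i) u k x₀ hx₀).continuousAt continuousAt_snd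
    refine continuousAt_const.mul (tendsto_finsetSum _ fun i _ => ?_)
    exact ContinuousAt.mul (by fun_prop) (this i)
  set c := G (v₀, x₀) / 2 with hc
  have hcpos : 0 < c := half_pos hσpos
  have hev : ∀ᶠ p in 𝓝 (v₀, x₀), c < G p := hGc.eventually_const_lt (half_lt_self hσpos)
  rw [nhds_prod_eq] at hev
  obtain ⟨pN, hpN, pB, hpB, hNB⟩ := eventually_prod_iff.1 hev
  obtain ⟨R, hR, hRB⟩ := Metric.eventually_nhds_iff_ball.1 (hpB.and (hU.mem_nhds hx₀))
  -- Segments of length at most `ρ` issued from the ball of radius `2 ρ` stay in the ball of radius `R`.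
  set ρ := R / 3 with hρ
  have hρpos : 0 < ρ := by positivity
  obtain ⟨τ, hτ, hτu⟩ : ∃ τ : ℝ, 0 < τ ∧ τ * ‖u‖ ≤ ρ := by
    refine ⟨ρ / (‖u‖ + 1), by positivity, ?_⟩
    rw [div_mul_eq_mul_div, div_le_iff₀ (by positivity)]
    exact mul_le_mul_of_nonneg_left (by linarith) hρpos.le
  refine ⟨{v | pN v}, hpN, Metric.ball x₀ ρ, Metric.ball_mem_nhds x₀ hρpos,
    (ENNReal.ofReal τ)⁻¹.toNNReal * (ENNReal.ofReal (2 ^ (k + 1) - 2)).toNNReal *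
      (μ (Metric.ball x₀ (2 * ρ))).toNNReal, k, c, hcpos, fun v hv h hh _ => ?_⟩
  have hsegU : ∀ y ∈ Metric.ball x₀ (2 * ρ), ∀ s ∈ Set.Icc 0 τ, y + s • u ∈ Metric.ball x₀ R := by
    intro y hy s hs
    rw [Metric.mem_ball, dist_eq_norm] at hy ⊢
    have h2 : ‖s • u‖ ≤ ρ := by
      rw [norm_smul, Real.norm_of_nonneg hs.1]
      exact (mul_le_mul_of_nonneg_right hs.2 (norm_nonneg u)).trans hτu
    calc ‖y + s • u - x₀‖ = ‖(y - x₀) + s • u‖ := by congr 1; abel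
      _ ≤ ‖y - x₀‖ + ‖s • u‖ := norm_add_le _ _
      _ < R := by linarith
  set S := {y ∈ Metric.ball x₀ ρ | |∑ i, v i * F i y| < c * h ^ k} with hS
  have hSm : MeasurableSet S := by
    have hcont : ContinuousOn (fun y => |∑ i, v i * F i y|) (Metric.ball x₀ ρ) := fun y hy =>
      ((hcomb v y (hRB y (Metric.ball_subset_ball (by linarith) hy)).2).continuousAt.abs
        ).continuousWithinAt
    exact (hcont.isOpen_inter_preimage Metric.isOpen_ball isOpen_Iio).measurableSet
  have hseg : ∀ y ∈ Metric.ball x₀ (2 * ρ), volume {s ∈ Set.Icc 0 τ | y + s • u ∈ S} ≤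
      ENNReal.ofReal ((2 ^ (k + 1) - 2) * h) := by
    intro y hy
    have hmain := volume_abs_lt_le k
      (fun i s => σ * (dirDeriv u)^[i] (fun y => ∑ i, v i * F i y) (y + s • u)) (Set.Icc 0 τ)
      Set.ordConnected_Icc (fun i _ s hs => (hasDerivAt_iterate_dirDeriv (hcomb v) u i
        (hRB _ (hsegU y hy s hs)).2).const_mul σ) hcpos hh (fun s hs => by
          rw [iterate_dirDeriv_sum hU hF v u k _ (hRB _ (hsegU y hy s hs)).2]
          exact (hNB hv (hRB _ (hsegU y hy s hs)).1).le)
    refine (measure_mono fun s hs => ?_).trans hmain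
    refine ⟨hs.1, ?_⟩
    rw [abs_mul, hσ, one_mul]
    exact hs.2.2
  have hfin := measure_le_of_segments μ hτu hSm (fun y hy => hy.1) hseg
  have hτ0 : ENNReal.ofReal τ ≠ 0 := by simpa using hτ
  have hpow : (0 : ℝ) ≤ 2 ^ (k + 1) - 2 := by
    have : (1 : ℝ) ≤ 2 ^ k := one_le_pow₀ (by norm_num)
    rw [pow_succ]
    linarith
  rw [ENNReal.coe_mul, ENNReal.coe_mul, ENNReal.coe_toNNReal (ENNReal.inv_ne_top.2 hτ0),
    ENNReal.coe_toNNReal ENNReal.ofReal_ne_top, ENNReal.coe_toNNReal measure_ball_lt_top.ne]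
  calc μ S = (ENNReal.ofReal τ)⁻¹ * (ENNReal.ofReal τ * μ S) := by
        rw [← mul_assoc, ENNReal.inv_mul_cancel hτ0 ENNReal.ofReal_ne_top, one_mul]
    _ ≤ (ENNReal.ofReal τ)⁻¹ * (ENNReal.ofReal ((2 ^ (k + 1) - 2) * h) *
          μ (Metric.ball x₀ (2 * ρ))) := by gcongr
    _ = _ := by
        rw [ENNReal.ofReal_mul hpow]
        ring

/-- Linearly independent analytic functions on a connected open set satisfy, near each of its
points, a sublevel estimate that is uniform over the coefficient vectors of norm at least one. By
the identity theorem no nontrivial combination vanishes near `x₀`; the unit sphere of coefficients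
is compact. -/
theorem uniformSublevel_of_linearIndependent [BorelSpace E] [FiniteDimensional ℝ E]
    [μ.IsAddHaarMeasure] {U : Set E} (hU : IsOpen U) (hUc : IsPreconnected U)
    (hF : ∀ i, AnalyticOnNhd ℝ (F i) U)
    (hind : ∀ v : ι → ℝ, v ≠ 0 → ∃ x ∈ U, ∑ i, v i * F i x ≠ 0) (hx₀ : x₀ ∈ U) :
    UniformSublevel μ F x₀ {v | 1 ≤ ‖v‖} := by
  have hsph : UniformSublevel μ F x₀ (Metric.sphere (0 : ι → ℝ) 1) := by
    refine (isCompact_sphere (0 : ι → ℝ) 1).induction_on (p := UniformSublevel μ F x₀)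
      ⟨Set.univ, univ_mem, 0, 0, 1, one_pos, fun v hv => hv.elim⟩ (fun s t hst ht => ht.mono hst)
      (fun s t => UniformSublevel.union) (fun v hv => ?_)
    have hv0 : v ≠ 0 := ne_zero_of_mem_unit_sphere ⟨v, hv⟩
    obtain ⟨x, hx, hxv⟩ := hind v hv0
    obtain ⟨N, hN, hNs⟩ := exists_nhds_uniformSublevel (μ := μ) hU hF hx₀ (v₀ := v) fun h0 =>
      hxv (AnalyticOnNhd.eqOn_zero_of_preconnected_of_eventuallyEq_zero
        (fun y hy => Finset.analyticAt_fun_sum _ fun i _ => analyticAt_const.mul (hF i y hy))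
        hUc hx₀ h0 hx)
    exact ⟨N, mem_nhdsWithin_of_mem_nhds hN, hNs⟩
  obtain ⟨V, hV, C, k, c, hc, H⟩ := hsph
  refine ⟨V, hV, C, k, c, hc, fun v hv h hh h1 => ?_⟩
  have hv : 1 ≤ ‖v‖ := hv
  have hvpos : 0 < ‖v‖ := one_pos.trans_le hv
  refine (measure_mono fun y hy => ?_).trans (H (‖v‖⁻¹ • v) ?_ h hh h1)
  · refine ⟨hy.1, lt_of_le_of_lt ?_ hy.2⟩
    have : ∑ i, (‖v‖⁻¹ • v) i * F i y = ‖v‖⁻¹ * ∑ i, v i * F i y := by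
      simp only [Pi.smul_apply, smul_eq_mul, mul_assoc, Finset.mul_sum]
    rw [this, abs_mul, abs_of_pos (inv_pos.2 hvpos)]
    exact mul_le_of_le_one_left (abs_nonneg _) (inv_le_one_of_one_le₀ hv)
  · rw [mem_sphere_zero_iff_norm, norm_smul, norm_inv, norm_norm, inv_mul_cancel₀ hvpos.ne']

end

end

/-! ### Diophantine properties of linearly independent analytic functions -/

/-- Near a point with a uniform sublevel estimate, almost every point is Diophantine: the vectors
with entries in `[-M, M]` number `(2 M + 1) ^ d`, each excludes a set of measure `O(h)` with
`h = (M + 1) ^ -(d + 2)`, and Borel-Cantelli applies. -/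
theorem UniformSublevel.exists_nhds_measure_eq_zero {X : Type*} [TopologicalSpace X]
    [MeasurableSpace X] {ι : Type*} [Fintype ι] {μ : Measure X} {F : ι → X → ℝ} {x₀ : X}
    (hF : UniformSublevel μ F x₀ {v | 1 ≤ ‖v‖}) :
    ∃ V ∈ 𝓝 x₀, μ {y ∈ V | ¬ ∃ C : ℝ, 0 < C ∧ ∃ s : ℕ, ∀ w : ι → ℤ, w ≠ 0 →
      C ≤ |∑ i, (w i : ℝ) * F i y| * (1 + ‖w‖) ^ s} = 0 := by
  classical
  obtain ⟨V, hV, C, k, c, hc, H⟩ := hF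
  refine ⟨V, hV, ?_⟩
  set d := Fintype.card ι
  set box : ℕ → Finset (ι → ℤ) := fun M =>
    (Fintype.piFinset fun _ => Finset.Icc (-(M : ℤ)) M).filter (· ≠ 0)
  set η : ℕ → ℝ := fun M => ((M + 1 : ℝ) ^ (d + 2))⁻¹ with hη
  have hM1 : ∀ M : ℕ, (1 : ℝ) ≤ M + 1 := fun M => by
    have : (0 : ℝ) ≤ M := M.cast_nonneg
    linarith
  have hηpos : ∀ M, 0 < η M := fun M => inv_pos.2 (pow_pos (one_pos.trans_le (hM1 M)) _)
  have hη1 : ∀ M, η M ≤ 1 := fun M => inv_le_one_of_one_le₀ (one_le_pow₀ (hM1 M))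
  set B : ℕ → Set X := fun M =>
    ⋃ w ∈ box M, {y ∈ V | |∑ i, (w i : ℝ) * F i y| < c * η M ^ k} with hB
  have hBM : ∀ M, μ (B M) ≤ ENNReal.ofReal (2 ^ d * C * ((M + 1 : ℝ) ^ 2)⁻¹) := by
    intro M
    have hcard : ((box M).card : ℝ) ≤ 2 ^ d * (M + 1 : ℝ) ^ d := by
      have h1 : (box M).card ≤ (2 * M + 1) ^ d := by
        refine (Finset.card_filter_le _ _).trans ?_
        rw [Fintype.card_piFinset, Finset.prod_const, Int.card_Icc]
        exact le_of_eq (by congr 1; omega)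
      rw [← mul_pow]
      calc ((box M).card : ℝ) ≤ (2 * M + 1 : ℝ) ^ d := by exact_mod_cast h1
        _ ≤ (2 * (M + 1 : ℝ)) ^ d := by gcongr; linarith
    have hone : ∀ w ∈ box M, μ {y ∈ V | |∑ i, (w i : ℝ) * F i y| < c * η M ^ k} ≤
        C * ENNReal.ofReal (η M) := by
      intro w hw
      refine H (fun i => (w i : ℝ)) ?_ (η M) (hηpos M) (hη1 M)
      obtain ⟨i, hi⟩ := Function.ne_iff.1 (Finset.mem_filter.1 hw).2
      refine le_trans ?_ (norm_le_pi_norm (fun i => (w i : ℝ)) i)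
      rw [Real.norm_eq_abs]
      exact_mod_cast Int.one_le_abs hi
    calc μ (B M) ≤ ∑ w ∈ box M, μ {y ∈ V | |∑ i, (w i : ℝ) * F i y| < c * η M ^ k} :=
          measure_biUnion_finset_le _ _
      _ ≤ ∑ w ∈ box M, C * ENNReal.ofReal (η M) := Finset.sum_le_sum hone
      _ = ENNReal.ofReal ((box M).card * (C * η M)) := by
          rw [Finset.sum_const, nsmul_eq_mul, ENNReal.ofReal_mul (Nat.cast_nonneg _),
            ENNReal.ofReal_mul C.coe_nonneg, ENNReal.ofReal_natCast, ENNReal.ofReal_coe_nnreal]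
      _ ≤ ENNReal.ofReal (2 ^ d * C * ((M + 1 : ℝ) ^ 2)⁻¹) := by
          refine ENNReal.ofReal_le_ofReal ?_
          have hMpos : (0 : ℝ) < M + 1 := one_pos.trans_le (hM1 M)
          calc ((box M).card : ℝ) * (C * η M) ≤ 2 ^ d * (M + 1 : ℝ) ^ d * (C * η M) :=
                mul_le_mul_of_nonneg_right hcard (mul_nonneg C.coe_nonneg (hηpos M).le)
            _ = 2 ^ d * C * ((M + 1 : ℝ) ^ 2)⁻¹ := by
                simp only [hη, pow_add]
                field_simp
  have hsum : ∑' M, μ (B M) ≠ ⊤ := by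
    refine ne_top_of_le_ne_top ?_ (ENNReal.tsum_le_tsum hBM)
    refine Summable.tsum_ofReal_ne_top (Summable.mul_left _ ?_)
    have := (summable_nat_add_iff 1).2 (Real.summable_nat_pow_inv.2 (one_lt_two))
    exact_mod_cast this
  refine measure_mono_null ?_ (measure_setOfPred_frequently_eq_zero hsum)
  rintro y ⟨hyV, hy⟩
  by_contra hnf
  obtain ⟨M₀, hM₀⟩ := eventually_atTop.1 (not_frequently.1 hnf)
  refine hy ⟨c / (M₀ + 2 : ℝ) ^ ((d + 2) * k), by positivity, (d + 2) * k, fun w hw => ?_⟩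
  set M := M₀ + ⌈‖w‖⌉₊ with hM
  have hwM : ‖w‖ ≤ M := (Nat.le_ceil _).trans (by exact_mod_cast Nat.le_add_left _ _)
  have hwbox : w ∈ box M := by
    refine Finset.mem_filter.2 ⟨Fintype.mem_piFinset.2 fun i => ?_, hw⟩
    have h1 : ‖w i‖ ≤ M := (norm_le_pi_norm w i).trans hwM
    rw [Int.norm_eq_abs] at h1
    exact Finset.mem_Icc.2 (abs_le.1 (by exact_mod_cast h1))
  have hlow : c * η M ^ k ≤ |∑ i, (w i : ℝ) * F i y| := by
    by_contra hlt
    exact hM₀ M (Nat.le_add_right _ _) (Set.mem_iUnion₂.2 ⟨w, hwbox, hyV, not_le.1 hlt⟩)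
  have hMle : (M + 1 : ℝ) ≤ (M₀ + 2) * (1 + ‖w‖) := by
    have h1 := Nat.ceil_lt_add_one (norm_nonneg w)
    have h2 : (M : ℝ) = M₀ + ⌈‖w‖⌉₊ := by rw [hM]; push_cast; rfl
    have h3 : 0 ≤ (M₀ : ℝ) * ‖w‖ := by positivity
    nlinarith [norm_nonneg w]
  have hMpos : (0 : ℝ) < M + 1 := one_pos.trans_le (hM1 M)
  have hηk : η M ^ k = ((M + 1 : ℝ) ^ ((d + 2) * k))⁻¹ := by
    rw [hη, inv_pow, ← pow_mul]
  rw [div_le_iff₀ (by positivity)]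
  calc c = c * η M ^ k * (M + 1 : ℝ) ^ ((d + 2) * k) := by
        rw [hηk, mul_assoc, inv_mul_cancel₀ (by positivity), mul_one]
    _ ≤ |∑ i, (w i : ℝ) * F i y| * ((M₀ + 2) * (1 + ‖w‖)) ^ ((d + 2) * k) := by
        gcongr
    _ = _ := by rw [mul_pow]; ring

/-- If analytic functions on a connected open set are linearly independent over `ℝ`, then at almost
every point their integer combinations are bounded below by a negative power of the size of the
coefficients. -/
theorem ae_diophantine {E : Type*} [NormedAddCommGroup E] [NormedSpace ℝ E] [MeasurableSpace E]
    [BorelSpace E] [FiniteDimensional ℝ E] (μ : Measure E) [μ.IsAddHaarMeasure] {ι : Type*}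
    [Fintype ι] {U : Set E} (hU : IsOpen U) (hUc : IsPreconnected U) {F : ι → E → ℝ}
    (hF : ∀ i, AnalyticOnNhd ℝ (F i) U)
    (hind : ∀ v : ι → ℝ, v ≠ 0 → ∃ x ∈ U, ∑ i, v i * F i x ≠ 0) :
    ∀ᵐ x ∂μ, x ∈ U → ∃ C : ℝ, 0 < C ∧ ∃ s : ℕ, ∀ w : ι → ℤ, w ≠ 0 →
      C ≤ |∑ i, (w i : ℝ) * F i x| * (1 + ‖w‖) ^ s := by
  have : ProperSpace E := FiniteDimensional.proper_real E
  refine measure_null_of_locally_null _ fun x hx => ?_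
  have hxU : x ∈ U := by
    by_contra h
    exact hx fun h' => (h h').elim
  obtain ⟨V, hV, hnull⟩ :=
    (uniformSublevel_of_linearIndependent (μ := μ) hU hUc hF hind hxU).exists_nhds_measure_eq_zero
  refine ⟨_, ?_, hnull⟩
  filter_upwards [mem_nhdsWithin_of_mem_nhds hV, self_mem_nhdsWithin] with y hy hyb
  exact ⟨hy, fun h => hyb fun _ => h⟩

/-! ### Hausdorff measure on an analytic graph -/

/-- The map onto the graph of an analytic function is locally Lipschitz, so it maps null sets of the
parameter domain to null sets of the two-dimensional Hausdorff measure. -/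
theorem hausdorffMeasure_graph_eq_zero {D N : Set (ℝ × ℝ)} {A : ℝ × ℝ → ℝ}
    (hA : AnalyticOnNhd ℝ A D) (hND : N ⊆ D) (hN : volume N = 0) :
    (Measure.hausdorffMeasure 2 : Measure (ℝ × ℝ × ℝ)) ((fun x => (A x, x)) '' N) = 0 := by
  refine measure_null_of_locally_null _ ?_
  rintro _ ⟨x, hx, rfl⟩
  have hsmooth : ContDiffAt ℝ 1 (fun x => (A x, x)) x :=
    (hA x (hND hx)).contDiffAt.prodMk contDiffAt_id
  obtain ⟨K, V, hV, hK⟩ := hsmooth.exists_lipschitzOnWith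
  refine ⟨(fun x => (A x, x)) '' (N ∩ V), ?_, ?_⟩
  · filter_upwards [mem_nhdsWithin_of_mem_nhds
      ((continuous_snd : Continuous (Prod.snd : ℝ × ℝ × ℝ → ℝ × ℝ)).continuousAt.preimage_mem_nhds
        (x := (A x, x)) hV), self_mem_nhdsWithin]
    rintro _ hyV ⟨y, hy, rfl⟩
    exact ⟨y, ⟨hy, hyV⟩, rfl⟩
  · refine le_antisymm ?_ zero_le
    refine ((hK.mono Set.inter_subset_right).hausdorffMeasure_image_le zero_le_two).trans ?_
    rw [hausdorffMeasure_prod_real, measure_mono_null Set.inter_subset_left hN, mul_zero]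

/-- A property that holds at almost every parameter holds at almost every point of an analytic
graph. -/
theorem ae_hausdorffMeasure_restrict_graph {D : Set (ℝ × ℝ)} (hD : IsOpen D) {A : ℝ × ℝ → ℝ}
    (hA : AnalyticOnNhd ℝ A D) {p : ℝ × ℝ × ℝ → Prop}
    (hp : ∀ᵐ x ∂(volume : Measure (ℝ × ℝ)), x ∈ D → p (A x, x)) :
    ∀ᵐ y ∂((Measure.hausdorffMeasure 2 : Measure (ℝ × ℝ × ℝ)).restrict
      ((fun x => (A x, x)) '' D)), p y := by
  have hmeas : MeasurableSet ((fun x => (A x, x)) '' D) :=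
    hD.measurableSet.image_of_continuousOn_injOn (hA.continuousOn.prodMk continuousOn_id)
      fun x _ y _ hxy => (Prod.ext_iff.1 hxy).2
  rw [ae_restrict_iff' hmeas]
  refine measure_mono_null ?_ (hausdorffMeasure_graph_eq_zero hA
    (N := {x ∈ D | ¬ p (A x, x)}) (fun x hx => hx.1) ?_)
  · intro y hy
    obtain ⟨⟨x, hx, rfl⟩, hpy⟩ := Classical.not_imp.1 hy
    exact ⟨x, ⟨hx, hpy⟩, rfl⟩
  · refine measure_mono_null (fun x hx => ?_) hp
    exact fun h => hx.2 (h hx.1)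

/-! ### Eigenvalues at a Silnikov saddle -/

/-- The formula also covers negative radicands, whose complex root is imaginary and whose real
`Real.sqrt` is zero. -/
theorem re_eigPlus (ε α β ω : ℝ) (n : ℕ) :
    (eigPlus ε α β ω n).re = -ε * (α + (n : ℝ) ^ 2) + 2 * √(radicand ε α β ω n) := by
  have h : ∀ x : ℝ, ((x : ℂ) ^ (1 / 2 : ℂ)).re = √x := by
    intro x
    rw [one_div, Complex.cpow_inv_two_re, Complex.norm_real, Complex.ofReal_re, Real.norm_eq_abs]
    rcases le_total 0 x with hx | hx
    · rw [abs_of_nonneg hx, add_self_div_two]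
    · rw [abs_of_nonpos hx, neg_add_cancel, zero_div, Real.sqrt_zero,
        Real.sqrt_eq_zero_of_nonpos hx]
  rw [eigPlus]
  have h1 : (-(ε : ℂ) * ((α : ℂ) + (n : ℂ) ^ 2)) = ((-ε * (α + (n : ℝ) ^ 2) : ℝ) : ℂ) := by
    push_cast
    ring
  rw [Complex.add_re, h1, Complex.ofReal_re, ← h]
  simp

theorem re_eigMinus (ε α β ω : ℝ) (n : ℕ) :
    (eigMinus ε α β ω n).re = -ε * (α + (n : ℝ) ^ 2) - 2 * √(radicand ε α β ω n) := by
  have h := re_eigPlus ε α β ω n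
  have h2 : eigPlus ε α β ω n + eigMinus ε α β ω n =
      ((2 * (-ε * (α + (n : ℝ) ^ 2)) : ℝ) : ℂ) := by
    rw [eigPlus, eigMinus]
    push_cast
    ring
  have h3 := congrArg Complex.re h2
  rw [Complex.add_re, Complex.ofReal_re] at h3
  linarith

section
variable {ε α β ω : ℝ}

theorem lt_sq_of_mem_stationaryIntensities {J : ℝ} (hε : 0 < ε) (hα : 0 < α)
    (hJ : J ∈ stationaryIntensities ε α β ω) : J < ω ^ 2 := by
  obtain ⟨hJ0, hJβ, hJe⟩ := hJ
  have h1 : α ^ 2 * J < β ^ 2 := by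
    have : (α * √J) ^ 2 < β ^ 2 := pow_lt_pow_left₀ hJβ (by positivity) two_ne_zero
    rwa [mul_pow, Real.sq_sqrt hJ0.le] at this
  have h2 : 0 < ε * √(β ^ 2 - α ^ 2 * J) := mul_pos hε (Real.sqrt_pos.2 (sub_pos.2 h1))
  rw [← hJe] at h2
  exact sub_pos.1 (pos_of_mul_pos_right h2 (by positivity))

theorem IsSilnikovSaddle.saddleIntensity_lt (h : IsSilnikovSaddle ε α β ω) (hε : 0 < ε)
    (hα : 0 < α) : saddleIntensity ε α β ω < ω ^ 2 :=
  lt_sq_of_mem_stationaryIntensities hε hα h.isGreatest.1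

/-- Positivity of `λ_0^+` bounds its radicand from below. -/
theorem IsSilnikovSaddle.lt_radicand_zero (h : IsSilnikovSaddle ε α β ω) (hε : 0 < ε)
    (hα : 0 < α) : (ε * α) ^ 2 < 4 * radicand ε α β ω 0 := by
  have h1 := h.unstable_pos
  rw [re_eigPlus] at h1
  have h2 : ε * α < 2 * √(radicand ε α β ω 0) := by
    norm_num at h1
    linarith
  have hpos : 0 < radicand ε α β ω 0 := by
    refine Real.sqrt_pos.1 ?_
    nlinarith [mul_pos hε hα]
  have h3 := pow_lt_pow_left₀ h2 (mul_pos hε hα).le two_ne_zero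
  rw [mul_pow 2, Real.sq_sqrt hpos.le] at h3
  linarith

theorem IsSilnikovSaddle.radicand_one_pos (h : IsSilnikovSaddle ε α β ω) (hε : 0 < ε)
    (hα : 0 < α) : 0 < radicand ε α β ω 1 := by
  have h1 := h.unstable_pos.trans h.unstable_lt
  rw [re_eigPlus] at h1
  refine Real.sqrt_pos.1 ?_
  norm_num at h1
  nlinarith [mul_pos hε hα]

theorem IsSilnikovSaddle.radicand_neg (h : IsSilnikovSaddle ε α β ω) (hε : 0 < ε)
    (hα : 0 < α) (hω : 1 / 2 < ω) (hω1 : ω < 1) {n : ℕ} (hn : 2 ≤ n) :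
    radicand ε α β ω n < 0 := by
  have hJ := h.saddleIntensity_lt hε hα
  have hn2 : (2 : ℝ) ≤ n := by exact_mod_cast hn
  refine mul_neg_of_pos_of_neg ?_ ?_
  · nlinarith
  · nlinarith

/-- The real part of each eigenvalue is `-ε (α + k) + 2 a √R₀ + 2 b √R₁` with integers `k`, `a`,
`b`, where `R₀` and `R₁` are the radicands of the two real pairs of eigenvalues. -/
theorem IsSilnikovSaddle.exists_re_eig (h : IsSilnikovSaddle ε α β ω) (hε : 0 < ε)
    (hα : 0 < α) (hω : 1 / 2 < ω) (hω1 : ω < 1) (m : ℤ) :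
    ∃ k a b : ℤ, |a| ≤ 1 ∧ |b| ≤ 1 ∧ (eig ε α β ω m).re =
      -ε * (α + k) + 2 * a * √(radicand ε α β ω 0) + 2 * b * √(radicand ε α β ω 1) := by
  have key : ∀ n : ℕ, ∃ a b : ℤ, |a| ≤ 1 ∧ |b| ≤ 1 ∧ √(radicand ε α β ω n) =
      a * √(radicand ε α β ω 0) + b * √(radicand ε α β ω 1) := by
    intro n
    rcases Nat.lt_or_ge n 2 with hn | hn
    · interval_cases n
      · exact ⟨1, 0, by simp, by simp, by simp⟩
      · exact ⟨0, 1, by simp, by simp, by simp⟩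
    · exact ⟨0, 0, by simp, by simp, by
        simp [Real.sqrt_eq_zero_of_nonpos (h.radicand_neg hε hα hω hω1 hn).le]⟩
  unfold eig
  split_ifs with hm
  · obtain ⟨a, b, ha, hb, hab⟩ := key m.toNat
    refine ⟨(m.toNat : ℤ) ^ 2, a, b, ha, hb, ?_⟩
    rw [re_eigPlus, hab]
    push_cast
    ring
  · obtain ⟨a, b, ha, hb, hab⟩ := key (-m - 1).toNat
    refine ⟨((-m - 1).toNat : ℤ) ^ 2, -a, -b, by rwa [abs_neg], by rwa [abs_neg], ?_⟩
    rw [re_eigMinus, hab]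
    push_cast
    ring

/-- The numbers whose integer combinations are the real parts of the small divisors. -/
noncomputable def divisorBasis (ε α β ω : ℝ) : Fin 4 → ℝ :=
  ![ε, ε * α, 2 * √(radicand ε α β ω 0), 2 * √(radicand ε α β ω 1)]

theorem IsSilnikovSaddle.exists_re_eig_sub_sum (h : IsSilnikovSaddle ε α β ω) (hε : 0 < ε)
    (hα : 0 < α) (hω : 1 / 2 < ω) (hω1 : ω < 1) {n : ℤ} (hn : 2 ≤ n) {r : ℕ} (l : Fin r → ℤ) :
    ∃ N a b : ℤ, |a| ≤ r ∧ |b| ≤ r ∧ (eig ε α β ω n - ∑ j, eig ε α β ω (l j)).re =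
      ∑ i, (![N, (r : ℤ) - 1, a, b] i : ℝ) * divisorBasis ε α β ω i := by
  choose k a b ha hb hre using h.exists_re_eig hε hα hω hω1
  have hbound : ∀ c : ℤ → ℤ, (∀ m, |c m| ≤ 1) → |-∑ j, c (l j)| ≤ r := by
    intro c hc
    rw [abs_neg]
    refine (Finset.abs_sum_le_sum_abs _ _).trans ((Finset.sum_le_sum fun j _ => hc (l j)).trans ?_)
    simp
  refine ⟨∑ j, k (l j) - n ^ 2, -∑ j, a (l j), -∑ j, b (l j), hbound a ha, hbound b hb, ?_⟩
  have hn0 : (eig ε α β ω n).re = -ε * (α + n ^ 2) := by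
    have hn' : (n.toNat : ℝ) = n := by exact_mod_cast Int.toNat_of_nonneg (by omega)
    rw [eig, if_pos (by omega), re_eigPlus, Real.sqrt_eq_zero_of_nonpos
      (h.radicand_neg hε hα hω hω1 (by omega)).le, hn']
    ring
  rw [Complex.sub_re, Complex.re_sum, hn0, Finset.sum_congr rfl fun j _ => hre (l j)]
  simp only [Finset.sum_add_distrib, ← Finset.mul_sum, ← Finset.sum_mul, Fin.sum_univ_four,
    divisorBasis, Matrix.cons_val]
  simp only [Finset.sum_const, Finset.card_univ, Fintype.card_fin, nsmul_eq_mul]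
  push_cast
  ring

/-- Only the real parts matter: a Diophantine condition on `ε`, `ε α` and the two real square roots
gives the nonresonance condition. The coefficient of `ε` is not bounded in terms of `r`, but when it
exceeds a multiple of `r` the divisor is at least one. -/
theorem IsSilnikovSaddle.siegelNonresonant (h : IsSilnikovSaddle ε α β ω) (hε : 0 < ε)
    (hα : 0 < α) (hω : 1 / 2 < ω) (hω1 : ω < 1) {C : ℝ} (hC : 0 < C) {s : ℕ}
    (hdio : ∀ w : Fin 4 → ℤ, w ≠ 0 →
      C ≤ |∑ i, (w i : ℝ) * divisorBasis ε α β ω i| * (1 + ‖w‖) ^ s) :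
    SiegelNonresonant ε α β ω := by
  set ρ₀ := √(radicand ε α β ω 0) with hρ₀
  set ρ₁ := √(radicand ε α β ω 1) with hρ₁
  have hρ₀0 : 0 ≤ ρ₀ := Real.sqrt_nonneg _
  have hρ₁0 : 0 ≤ ρ₁ := Real.sqrt_nonneg _
  set K := (1 + ε * α + 2 * ρ₀ + 2 * ρ₁) / ε with hK
  have hK0 : 0 ≤ K := by positivity
  -- As `r ≥ 2`, the constant `C / (2 + K) ^ s` is at least `1 / r ^ t`.
  obtain ⟨t, ht⟩ := exists_pow_lt_of_lt_one (show 0 < C / (2 + K) ^ s by positivity)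
    (show (1 / 2 : ℝ) < 1 by norm_num)
  refine ⟨s + t, fun n hn r hr hrn l => ?_⟩
  obtain ⟨N, a, b, ha, hb, hre⟩ := h.exists_re_eig_sub_sum hε hα hω hω1 hn l
  refine ge_iff_le.2 (le_trans ?_ (Complex.abs_re_le_norm _))
  rw [hre]
  set w : Fin 4 → ℤ := ![N, (r : ℤ) - 1, a, b] with hw
  have hr2 : (2 : ℝ) ≤ r := by exact_mod_cast hr
  have hrpos : (0 : ℝ) < r := by linarith
  rcases le_or_gt 1 |∑ i, (w i : ℝ) * divisorBasis ε α β ω i| with hbig | hsmall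
  · refine le_trans ?_ hbig
    rw [div_le_one (by positivity)]
    exact one_le_pow₀ (by linarith)
  have hw0 : w ≠ 0 := fun h0 => by
    have : w 1 = 0 := by rw [h0]; rfl
    simp only [hw, Matrix.cons_val] at this
    omega
  have haR : |(a : ℝ)| ≤ r := by exact_mod_cast ha
  have hbR : |(b : ℝ)| ≤ r := by exact_mod_cast hb
  have hNK : |(N : ℝ)| ≤ K * r := by
    rw [hK, div_mul_eq_mul_div, le_div_iff₀ hε]
    have hN : (N : ℝ) * ε = ∑ i, (w i : ℝ) * divisorBasis ε α β ω i -
        ((r - 1) * (ε * α) + a * (2 * ρ₀) + b * (2 * ρ₁)) := by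
      simp only [Fin.sum_univ_four, divisorBasis, hw, Matrix.cons_val]
      push_cast
      ring
    rw [← abs_of_pos hε, ← abs_mul, hN, abs_of_pos hε]
    have h1 : |(r - 1) * (ε * α)| ≤ r * (ε * α) := by
      rw [abs_of_nonneg (mul_nonneg (by linarith) (by positivity))]
      exact mul_le_mul_of_nonneg_right (by linarith) (by positivity)
    have h2 : |a * (2 * ρ₀)| ≤ r * (2 * ρ₀) := by
      rw [abs_mul, abs_of_nonneg (by positivity : 0 ≤ 2 * ρ₀)]
      exact mul_le_mul_of_nonneg_right haR (by positivity)
    have h3 : |b * (2 * ρ₁)| ≤ r * (2 * ρ₁) := by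
      rw [abs_mul, abs_of_nonneg (by positivity : 0 ≤ 2 * ρ₁)]
      exact mul_le_mul_of_nonneg_right hbR (by positivity)
    calc _ ≤ |∑ i, (w i : ℝ) * divisorBasis ε α β ω i| +
          |(r - 1) * (ε * α) + a * (2 * ρ₀) + b * (2 * ρ₁)| := abs_sub _ _
      _ ≤ 1 + (r * (ε * α) + r * (2 * ρ₀) + r * (2 * ρ₁)) :=
          add_le_add hsmall.le ((abs_add_three _ _ _).trans (by gcongr))
      _ ≤ (1 + ε * α + 2 * ρ₀ + 2 * ρ₁) * r := by nlinarith
  have hwnorm : 1 + ‖w‖ ≤ (2 + K) * r := by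
    have : ‖w‖ ≤ (1 + K) * r := by
      refine (pi_norm_le_iff_of_nonneg (by positivity)).2 fun i => ?_
      rw [Int.norm_eq_abs]
      fin_cases i <;> simp only [hw, Fin.zero_eta, Fin.mk_one, Fin.reduceFinMk, Matrix.cons_val]
      · nlinarith
      · push_cast
        rw [abs_of_nonneg (by linarith)]
        nlinarith
      · nlinarith
      · nlinarith
    nlinarith
  have hf := hdio w hw0
  have hlow : C / (2 + K) ^ s / (r : ℝ) ^ s ≤ |∑ i, (w i : ℝ) * divisorBasis ε α β ω i| := by
    rw [div_div, ← mul_pow, div_le_iff₀ (by positivity)]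
    refine hf.trans ?_
    gcongr
  refine le_trans ?_ hlow
  rw [pow_add, mul_comm, ← div_div]
  refine div_le_div_of_nonneg_right (le_trans ?_ ht.le) (by positivity)
  rw [one_div_pow]
  exact one_div_le_one_div_of_le (by positivity) (by gcongr)

end

/-! ### Analytic dependence of the saddle on the parameters -/

/-- The cubic whose roots in `J` are the solutions of the squared equation of the stationary
intensities. -/
def saddleCubic (ε α β ω J : ℝ) : ℝ :=
  4 * J * (ω ^ 2 - J) ^ 2 - ε ^ 2 * (β ^ 2 - α ^ 2 * J)

/-- The derivative of `saddleCubic` with respect to `J`. -/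
def saddleCubicDeriv (ε α ω J : ℝ) : ℝ :=
  4 * (ω ^ 2 - J) * (ω ^ 2 - 3 * J) + (ε * α) ^ 2

/-- A cubic with positive leading coefficient has at most one root with negative derivative, the
middle one of three. -/
theorem eq_of_saddleCubic_eq_zero {ε α β ω s t : ℝ} (hs : saddleCubic ε α β ω s = 0)
    (ht : saddleCubic ε α β ω t = 0) (hs' : saddleCubicDeriv ε α ω s < 0)
    (ht' : saddleCubicDeriv ε α ω t < 0) : s = t := by
  simp only [saddleCubic, saddleCubicDeriv] at hs ht hs' ht'
  by_contra hne
  have hq : 4 * (s ^ 2 + s * t + t ^ 2) - 8 * ω ^ 2 * (s + t) + 4 * ω ^ 4 + (ε * α) ^ 2 = 0 := by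
    refine (mul_eq_zero.1 (?_ : (s - t) * _ = 0)).resolve_left (sub_ne_zero.2 hne)
    linear_combination hs - ht
  have h1 : (s - t) * (2 * s + t - 2 * ω ^ 2) < 0 := by linarith
  have h2 : (t - s) * (2 * t + s - 2 * ω ^ 2) < 0 := by linarith
  nlinarith [sq_pos_of_ne_zero (sub_ne_zero.2 hne)]

theorem IsSilnikovSaddle.saddleCubic_eq_zero {ε α β ω : ℝ} (h : IsSilnikovSaddle ε α β ω)
    (hα : 0 < α) : saddleCubic ε α β ω (saddleIntensity ε α β ω) = 0 := by
  obtain ⟨hJ0, hJβ, hJe⟩ := h.isGreatest.1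
  set J := saddleIntensity ε α β ω
  have h1 : 0 ≤ β ^ 2 - α ^ 2 * J := by
    have : (α * √J) ^ 2 < β ^ 2 := pow_lt_pow_left₀ hJβ (by positivity) two_ne_zero
    rw [mul_pow, Real.sq_sqrt hJ0.le] at this
    linarith
  have h2 := congrArg (· ^ 2) hJe
  simp only [mul_pow, Real.sq_sqrt hJ0.le, Real.sq_sqrt h1] at h2
  rw [saddleCubic]
  linarith

/-- Positivity of `λ_0^+` says that the saddle intensity is a simple root of the cubic. -/
theorem IsSilnikovSaddle.saddleCubicDeriv_neg {ε α β ω : ℝ} (h : IsSilnikovSaddle ε α β ω)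
    (hε : 0 < ε) (hα : 0 < α) : saddleCubicDeriv ε α ω (saddleIntensity ε α β ω) < 0 := by
  have := h.lt_radicand_zero hε hα
  simp only [radicand, Nat.cast_zero] at this
  rw [saddleCubicDeriv]
  nlinarith

/-- The saddle intensity is analytic along an analytic surface of Silnikov saddles, by the analytic
implicit function theorem: near each point the implicit function is a root with negative
derivative, and such a root is unique. -/
theorem analyticOnNhd_saddleIntensity {ε : ℝ} (hε : 0 < ε) {D : Set (ℝ × ℝ)} (hD : IsOpen D)
    {A : ℝ × ℝ → ℝ} (hA : AnalyticOnNhd ℝ A D) (hApos : ∀ x ∈ D, 0 < A x)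
    (hS : ∀ x ∈ D, IsSilnikovSaddle ε (A x) x.1 x.2) :
    AnalyticOnNhd ℝ (fun x => saddleIntensity ε (A x) x.1 x.2) D := by
  intro x hx
  set J := fun x : ℝ × ℝ => saddleIntensity ε (A x) x.1 x.2 with hJ
  set f : (ℝ × ℝ) × ℝ → ℝ := fun p => saddleCubic ε (A p.1) p.1.1 p.1.2 p.2 with hf
  have hAc : ContDiffAt ℝ ⊤ A x := (hA x hx).contDiffAt
  have hAf : ContDiffAt ℝ ⊤ (fun p : (ℝ × ℝ) × ℝ => A p.1) (x, J x) :=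
    ContDiffAt.comp (g := A) (f := Prod.fst) (x, J x) hAc contDiffAt_fst
  have hfc : ContDiffAt ℝ ⊤ f (x, J x) := by
    simp only [hf, saddleCubic]
    fun_prop
  have hfd : HasDerivAt (fun j => f (x, j)) (saddleCubicDeriv ε (A x) x.2 (J x)) (J x) := by
    simp only [hf, saddleCubic, saddleCubicDeriv]
    have h1 : HasDerivAt (fun j : ℝ => x.2 ^ 2 - j) (-1) (J x) := by
      simpa using (hasDerivAt_id (J x)).const_sub (x.2 ^ 2)
    have h2 : HasDerivAt (fun j : ℝ => 4 * j) 4 (J x) := by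
      simpa using (hasDerivAt_id (J x)).const_mul 4
    have h3 : HasDerivAt (fun j : ℝ => ε ^ 2 * (x.1 ^ 2 - A x ^ 2 * j))
        (ε ^ 2 * -(A x ^ 2 * 1)) (J x) :=
      (((hasDerivAt_id (J x)).const_mul (A x ^ 2)).const_sub (x.1 ^ 2)).const_mul (ε ^ 2)
    refine ((h2.mul (h1.pow 2)).sub h3).congr_deriv ?_
    simp only [Pi.pow_apply]
    push_cast
    ring
  have hneg := (hS x hx).saddleCubicDeriv_neg hε (hApos x hx)
  have happly : (fderiv ℝ f (x, J x)) (0, 1) = saddleCubicDeriv ε (A x) x.2 (J x) := by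
    have hline : HasDerivAt (fun j : ℝ => (x, j)) ((0 : ℝ × ℝ), (1 : ℝ)) (J x) :=
      (hasDerivAt_const _ _).prodMk (hasDerivAt_id _)
    exact ((hfc.differentiableAt (by simp)).hasFDerivAt.comp_hasDerivAt (J x) hline).unique hfd
  have hinv : (fderiv ℝ f (x, J x) ∘L .inr ℝ (ℝ × ℝ) ℝ).IsInvertible := by
    refine ⟨ContinuousLinearEquiv.unitsEquivAut ℝ (Units.mk0 _ hneg.ne), ?_⟩
    ext
    simpa using happly.symm
  have hψ := hfc.contDiffAt_implicitFunction (by simp) hinv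
  have hψ0 := hfc.eventually_apply_implicitFunction (by simp) hinv
  have hψx := hfc.implicitFunction_apply_self (by simp) hinv
  set ψ := hfc.implicitFunction (by simp) hinv
  have hψ : ContDiffAt ℝ ⊤ ψ x := hψ
  have hψx : ψ x = J x := hψx
  have hcont : ContinuousAt (fun y => saddleCubicDeriv ε (A y) y.2 (ψ y)) x := by
    have h1 := hψ.continuousAt
    have h2 := (hA x hx).continuousAt
    simp only [saddleCubicDeriv]
    fun_prop
  have hev : ∀ᶠ y in 𝓝 x, saddleCubicDeriv ε (A y) y.2 (ψ y) < 0 :=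
    hcont.eventually_lt_const (by beta_reduce; rwa [hψx])
  have heq : ψ =ᶠ[𝓝 x] J := by
    filter_upwards [hψ0, hev, hD.mem_nhds hx] with y hy hy' hyD
    refine eq_of_saddleCubic_eq_zero (hy.trans ((hS x hx).saddleCubic_eq_zero (hApos x hx)))
      ((hS y hyD).saddleCubic_eq_zero (hApos y hyD)) hy'
      ((hS y hyD).saddleCubicDeriv_neg hε (hApos y hyD))
  exact (hψ.congr_of_eventuallyEq heq.symm).analyticAt

theorem analyticOnNhd_divisorBasis {ε : ℝ} (hε : 0 < ε) {D : Set (ℝ × ℝ)} (hD : IsOpen D)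
    {A : ℝ × ℝ → ℝ} (hA : AnalyticOnNhd ℝ A D) (hApos : ∀ x ∈ D, 0 < A x)
    (hS : ∀ x ∈ D, IsSilnikovSaddle ε (A x) x.1 x.2) (i : Fin 4) :
    AnalyticOnNhd ℝ (fun x => divisorBasis ε (A x) x.1 x.2 i) D := by
  have hJ := analyticOnNhd_saddleIntensity hε hD hA hApos hS
  have hR : ∀ n : ℕ, ∀ x ∈ D, radicand ε (A x) x.1 x.2 n ≠ 0 →
      AnalyticAt ℝ (fun x => 2 * √(radicand ε (A x) x.1 x.2 n)) x := by
    intro n x hx hn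
    have h1 : ContDiffAt ℝ ⊤ (fun x => radicand ε (A x) x.1 x.2 n) x := by
      have := (hJ x hx).contDiffAt (n := ⊤)
      simp only [radicand]
      fun_prop
    exact (contDiffAt_const.mul (h1.sqrt hn)).analyticAt
  intro x hx
  fin_cases i
  · exact analyticAt_const
  · exact analyticAt_const.mul (hA x hx)
  · refine hR 0 x hx ?_
    have := (hS x hx).lt_radicand_zero hε (hApos x hx)
    nlinarith [sq_nonneg (ε * A x)]
  · exact hR 1 x hx ((hS x hx).radicand_one_pos hε (hApos x hx)).ne'

/-! ### Linear independence in the limit of small `ε` -/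

/-- The saddle intensity tends to `ω²` as `ε → 0`: by the intermediate value theorem there are
stationary intensities arbitrarily close to `ω²`. -/
theorem tendsto_saddleIntensity {α₀ β ω : ℝ} (hα₀ : 0 < α₀) (hβ : α₀ * ω < β) (hω : 0 < ω) :
    Tendsto (fun p : ℝ × ℝ => saddleIntensity p.1 p.2 β ω) (𝓝[>] 0 ×ˢ 𝓝 α₀) (𝓝 (ω ^ 2)) := by
  have hε : ∀ᶠ p : ℝ × ℝ in 𝓝[>] 0 ×ˢ 𝓝 α₀, 0 < p.1 := tendsto_fst self_mem_nhdsWithin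
  have hα : ∀ᶠ p : ℝ × ℝ in 𝓝[>] 0 ×ˢ 𝓝 α₀, 0 < p.2 ∧ p.2 * ω < β :=
    tendsto_snd.eventually ((eventually_gt_nhds hα₀).and
      ((continuous_id.mul continuous_const).continuousAt.eventually_lt_const hβ))
  refine tendsto_order.2 ⟨fun a ha => ?_, fun a ha => ?_⟩
  · obtain ⟨m, hm, hmω⟩ := exists_between (max_lt ha (by positivity : 0 < ω ^ 2))
    obtain ⟨ham, hm0⟩ := max_lt_iff.1 hm
    have hsmall : ∀ᶠ p : ℝ × ℝ in 𝓝[>] 0 ×ˢ 𝓝 α₀,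
        p.1 * √(β ^ 2 - p.2 ^ 2 * m) < 2 * √m * (ω ^ 2 - m) := by
      have hlim : Tendsto (fun p : ℝ × ℝ => p.1 * √(β ^ 2 - p.2 ^ 2 * m)) (𝓝 (0, α₀)) (𝓝 0) := by
        have : Continuous fun p : ℝ × ℝ => p.1 * √(β ^ 2 - p.2 ^ 2 * m) := by fun_prop
        simpa using this.tendsto (0, α₀)
      rw [nhds_prod_eq] at hlim
      exact (hlim.mono_left (prod_mono nhdsWithin_le_nhds le_rfl)).eventually_lt_const
        (mul_pos (by positivity) (sub_pos.2 hmω))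
    filter_upwards [hε, hα, hsmall] with p hp1 hp2 hp3
    have hcont : ContinuousOn
        (fun J => 2 * √J * (ω ^ 2 - J) - p.1 * √(β ^ 2 - p.2 ^ 2 * J)) (Set.Icc m (ω ^ 2)) := by
      fun_prop
    have hend : 2 * √(ω ^ 2) * (ω ^ 2 - ω ^ 2) - p.1 * √(β ^ 2 - p.2 ^ 2 * ω ^ 2) ≤ 0 := by
      rw [sub_self, mul_zero, zero_sub]
      exact neg_nonpos.2 (mul_nonneg hp1.le (Real.sqrt_nonneg _))
    obtain ⟨J, hJ, hJ0⟩ := intermediate_value_Icc' hmω.le hcont ⟨hend, (sub_pos.2 hp3).le⟩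
    have hJmem : J ∈ stationaryIntensities p.1 p.2 β ω := by
      refine ⟨hm0.trans_le hJ.1, lt_of_le_of_lt ?_ hp2.2, sub_eq_zero.1 hJ0⟩
      exact mul_le_mul_of_nonneg_left ((Real.sqrt_le_left hω.le).2 hJ.2) hp2.1.le
    exact ham.trans_le (hJ.1.trans (le_csSup
      ⟨ω ^ 2, fun K hK => (lt_sq_of_mem_stationaryIntensities hp1 hp2.1 hK).le⟩ hJmem))
  · filter_upwards [hε, hα] with p hp1 hp2
    exact (Real.sSup_le (fun K hK => (lt_sq_of_mem_stationaryIntensities hp1 hp2.1 hK).le)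
      (by positivity)).trans_lt ha

/-- The functions `1`, `α`, `√R₀ / √ε`, `√R₁` as functions of the parameters and the saddle
intensity `J`; in the third, `(ω² - J) / ε` is eliminated by the equation of `J`. -/
noncomputable def scaledBasis (α J : ℝ) (x : ℝ × ℝ) : Fin 4 → ℝ :=
  ![1, α, √(√(x.1 ^ 2 - α ^ 2 * J) / (2 * √J) * (3 * J - x.2 ^ 2)),
    √((1 / 2 + x.2 ^ 2 - J) * (3 * J - x.2 ^ 2 - 1 / 2))]

theorem continuousAt_scaledBasis (x : ℝ × ℝ) {α J : ℝ} (hJ : 0 < J) :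
    ContinuousAt (fun p : ℝ × ℝ => scaledBasis p.1 p.2 x) (α, J) := by
  refine continuousAt_pi.2 fun i => ?_
  have hJ' : 2 * √J ≠ 0 := by positivity
  fin_cases i <;> simp only [scaledBasis, Fin.zero_eta, Fin.mk_one, Fin.reduceFinMk,
    Matrix.cons_val]
  · fun_prop
  · fun_prop
  · refine ContinuousAt.sqrt (ContinuousAt.mul (ContinuousAt.div ?_ ?_ hJ') ?_) <;> fun_prop
  · fun_prop

/-- The basis of the divisors is the scaled basis up to nonzero constant factors. -/
theorem IsSilnikovSaddle.divisorBasis_eq {ε α β ω : ℝ} (h : IsSilnikovSaddle ε α β ω) (hε : 0 < ε)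
    (i : Fin 4) : divisorBasis ε α β ω i =
      (![ε, ε, 2 * √ε, 2] : Fin 4 → ℝ) i *
        scaledBasis α (saddleIntensity ε α β ω) (β, ω) i := by
  obtain ⟨hJ0, -, hJe⟩ := h.isGreatest.1
  set J := saddleIntensity ε α β ω with hJ
  have h0 : radicand ε α β ω 0 =
      ε * (√(β ^ 2 - α ^ 2 * J) / (2 * √J) * (3 * J - ω ^ 2)) := by
    have hs : 2 * √J ≠ 0 := by positivity
    have hu : ω ^ 2 - J = ε * √(β ^ 2 - α ^ 2 * J) / (2 * √J) := by
      rw [eq_div_iff hs, ← hJe]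
      ring
    simp only [radicand, Nat.cast_zero, ← hJ]
    rw [show (0 : ℝ) ^ 2 / 2 + ω ^ 2 - J = ω ^ 2 - J by ring, hu]
    ring
  have h1 : radicand ε α β ω 1 = (1 / 2 + ω ^ 2 - J) * (3 * J - ω ^ 2 - 1 / 2) := by
    simp only [radicand, Nat.cast_one, ← hJ]
    ring
  fin_cases i <;> simp only [scaledBasis, divisorBasis, Fin.zero_eta, Fin.mk_one, Fin.reduceFinMk,
    Matrix.cons_val]
  · ring
  · rw [h0, Real.sqrt_mul hε.le, mul_assoc]
  · rw [h1]

/-- `arctan` is not a rational function with the denominator that occurs in `kappa`. The relation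
extends to all real `σ` by analyticity; it is then tested at `σ = ±1` and `σ = √3`. -/
theorem eq_zero_of_arctan_relation {a b c σ₀ : ℝ}
    (h : ∀ᶠ σ in 𝓝 σ₀, (a + b * σ) * ((1 + σ ^ 2) * Real.arctan σ - σ) + c * σ ^ 3 = 0) :
    a = 0 ∧ b = 0 ∧ c = 0 := by
  have han : AnalyticOnNhd ℝ
      (fun σ : ℝ => (a + b * σ) * ((1 + σ ^ 2) * Real.arctan σ - σ) + c * σ ^ 3) Set.univ := by
    intro σ _
    have : ContDiffAt ℝ ⊤ Real.arctan σ := Real.contDiff_arctan.contDiffAt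
    exact ContDiffAt.analyticAt (by fun_prop)
  have hall := fun σ : ℝ => han.eqOn_zero_of_preconnected_of_eventuallyEq_zero
    isPreconnected_univ (Set.mem_univ σ₀) h (Set.mem_univ σ)
  have h1 := hall 1
  have h2 := hall (-1)
  have h3 := hall √3
  have hs : √3 ^ 2 = 3 := Real.sq_sqrt (by norm_num)
  have hs3 : √3 ^ 3 = 3 * √3 := by rw [pow_succ, hs]
  have hs0 : 0 < √3 := by positivity
  simp only [Pi.zero_apply, Real.arctan_neg, Real.arctan_one, Real.arctan_sqrt_three, hs3, hs]
    at h1 h2 h3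
  have hπ := Real.pi_gt_three
  have hb : b = 0 := by
    refine (mul_eq_zero.1 (?_ : b * (Real.pi - 2) = 0)).resolve_right (by linarith)
    linear_combination h1 + h2
  subst hb
  have ha : a = 0 := by
    refine (mul_eq_zero.1 (?_ : a * (Real.pi * (4 / 3 - 3 / 2 * √3) + 2 * √3) = 0)).resolve_right ?_
    · linear_combination h3 - 3 * √3 * h1
    · have : √3 > 1.7 := Real.lt_sqrt_of_sq_lt (by norm_num)
      nlinarith
  subst ha
  exact ⟨rfl, rfl, by linarith⟩

theorem linearIndependent_scaledBasis {D : Set (ℝ × ℝ)} (hD : IsOpen D) (hne : D.Nonempty)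
    (hDs : D ⊆ baseRegion) {v : Fin 4 → ℝ}
    (hv : ∀ x ∈ D, ∑ i, v i * scaledBasis (1 / kappa x.2) (x.2 ^ 2) x i = 0) : v = 0 := by
  obtain ⟨⟨β₀, ω₀⟩, hx₀⟩ := hne
  obtain ⟨hω, hω1, hκ, hβ⟩ := hDs hx₀
  simp only at hω hω1 hκ hβ
  simp only [Fin.sum_univ_four, scaledBasis, Matrix.cons_val] at hv
  -- Only the third function depends on `β`, and it is strictly increasing in `β`.
  have hv2 : v 2 = 0 := by
    have hev : ∀ᶠ β in 𝓝[>] β₀, (β, ω₀) ∈ D := mem_nhdsWithin_of_mem_nhds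
      ((by fun_prop : Continuous fun β : ℝ => (β, ω₀)).continuousAt.preimage_mem_nhds
        (hD.mem_nhds hx₀))
    obtain ⟨β₁, hβ₁, hlt⟩ := (hev.and self_mem_nhdsWithin).exists
    have hlt : β₀ < β₁ := hlt
    have h0 := hv _ hx₀
    have h1 := hv _ hβ₁
    simp only at h0 h1
    have hpos : 0 < ω₀ / kappa ω₀ := div_pos (by linarith) hκ
    have hm : (1 / kappa ω₀) ^ 2 * ω₀ ^ 2 = (ω₀ / kappa ω₀) ^ 2 := by ring
    have hpos0 : 0 < β₀ ^ 2 - (1 / kappa ω₀) ^ 2 * ω₀ ^ 2 := by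
      rw [hm]
      nlinarith
    have hstrict : √(√(β₀ ^ 2 - (1 / kappa ω₀) ^ 2 * ω₀ ^ 2) / (2 * √(ω₀ ^ 2)) *
        (3 * ω₀ ^ 2 - ω₀ ^ 2)) < √(√(β₁ ^ 2 - (1 / kappa ω₀) ^ 2 * ω₀ ^ 2) / (2 * √(ω₀ ^ 2)) *
        (3 * ω₀ ^ 2 - ω₀ ^ 2)) := by
      have hω2 : 0 < 3 * ω₀ ^ 2 - ω₀ ^ 2 := by nlinarith
      have hω3 : 0 < 2 * √(ω₀ ^ 2) := by positivity
      refine Real.sqrt_lt_sqrt (by positivity) (mul_lt_mul_of_pos_right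
        (div_lt_div_of_pos_right (Real.sqrt_lt_sqrt hpos0.le ?_) hω3) hω2)
      nlinarith
    refine (mul_eq_zero.1 (?_ : v 2 * (_ - _) = 0)).resolve_right (sub_pos.2 hstrict).ne'
    linear_combination h1 - h0
  -- The other three give a relation between `arctan σ` and rational functions of `σ`.
  set σ₀ := √(4 * ω₀ ^ 2 - 1) with hσ₀
  have hσ₀pos : 0 < σ₀ := Real.sqrt_pos.2 (by nlinarith)
  have hωσ₀ : √(σ₀ ^ 2 + 1) / 2 = ω₀ := by
    rw [hσ₀, Real.sq_sqrt (by nlinarith), sub_add_cancel,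
      show 4 * ω₀ ^ 2 = (2 * ω₀) ^ 2 by ring, Real.sqrt_sq (by linarith)]
    ring
  have hev : ∀ᶠ σ in 𝓝 σ₀, (β₀, √(σ ^ 2 + 1) / 2) ∈ D := by
    refine (by fun_prop : Continuous fun σ : ℝ =>
      (β₀, √(σ ^ 2 + 1) / 2)).continuousAt.preimage_mem_nhds ?_
    rw [hωσ₀]
    exact hD.mem_nhds hx₀
  have hrel : ∀ᶠ σ in 𝓝 σ₀, (3 * v 0 + 3 / 2 * v 3 * σ) * ((1 + σ ^ 2) * Real.arctan σ - σ) +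
      2 * v 1 * σ ^ 3 = 0 := by
    filter_upwards [hev, lt_mem_nhds hσ₀pos] with σ hσD hσ
    have h0 := hv _ hσD
    have hκ := (hDs hσD).2.2.1
    simp only [hv2, zero_mul, add_zero] at h0 hκ
    set w := √(σ ^ 2 + 1) / 2 with hw
    have hw2 : 4 * w ^ 2 = σ ^ 2 + 1 := by
      rw [hw, div_pow, Real.sq_sqrt (by positivity)]
      ring
    have hσw : √(4 * w ^ 2 - 1) = σ := by
      rw [hw2, add_sub_cancel_right, Real.sqrt_sq hσ.le]
    have hlast : √((1 / 2 + w ^ 2 - w ^ 2) * (3 * w ^ 2 - w ^ 2 - 1 / 2)) = σ / 2 := by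
      rw [show (1 / 2 + w ^ 2 - w ^ 2) * (3 * w ^ 2 - w ^ 2 - 1 / 2) = (σ / 2) ^ 2 by
        linear_combination hw2 / 4, Real.sqrt_sq (by positivity)]
    have hkap : kappa w * (2 * σ ^ 3) = 3 * ((1 + σ ^ 2) * Real.arctan σ - σ) := by
      simp only [kappa, hσw]
      field_simp
    have hinv : 1 / kappa w * kappa w = 1 := one_div_mul_cancel hκ.ne'
    rw [hlast] at h0
    linear_combination (2 * σ ^ 3 * kappa w) * h0 - (v 0 + v 3 * σ / 2) * hkap -
      2 * σ ^ 3 * v 1 * hinv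
  obtain ⟨h0, h3, h1⟩ := eq_zero_of_arctan_relation hrel
  ext i
  fin_cases i <;> simp only [Fin.zero_eta, Fin.mk_one, Fin.reduceFinMk, Pi.zero_apply] <;> linarith

/-- Linear independence persists under perturbations that are small at every point: by compactness
of the unit sphere of coefficients. The perturbation parameter `α` may depend on the point. -/
theorem exists_independent_of_tendsto {X ι : Type*} [Fintype ι] {D : Set X} {F₀ : X → ι → ℝ}
    {Φ : ℝ → ℝ → X → ι → ℝ} {α₀ : X → ℝ}
    (hΦ : ∀ x ∈ D, Tendsto (fun p : ℝ × ℝ => Φ p.1 p.2 x) (𝓝[>] 0 ×ˢ 𝓝 (α₀ x)) (𝓝 (F₀ x)))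
    (hF₀ : ∀ v : ι → ℝ, v ≠ 0 → ∃ x ∈ D, ∑ i, v i * F₀ x i ≠ 0) :
    ∃ ε₀ : ℝ, 0 < ε₀ ∧ ∃ δ : ℝ, 0 < δ ∧ ∀ ε : ℝ, 0 < ε → ε < ε₀ → ∀ A : X → ℝ,
      (∀ x ∈ D, |A x - α₀ x| < δ) → ∀ v : ι → ℝ, v ≠ 0 → ∃ x ∈ D, ∑ i, v i * Φ ε (A x) x i ≠ 0 := by
  obtain ⟨ε₀, hε₀, δ, hδ, H⟩ : ∃ ε₀ : ℝ, 0 < ε₀ ∧ ∃ δ : ℝ, 0 < δ ∧ ∀ ε : ℝ, 0 < ε → ε < ε₀ →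
      ∀ A : X → ℝ, (∀ x ∈ D, |A x - α₀ x| < δ) → ∀ v ∈ Metric.sphere (0 : ι → ℝ) 1,
        ∃ x ∈ D, ∑ i, v i * Φ ε (A x) x i ≠ 0 := by
    refine (isCompact_sphere (0 : ι → ℝ) 1).induction_on (p := fun N : Set (ι → ℝ) =>
      ∃ ε₀ : ℝ, 0 < ε₀ ∧ ∃ δ : ℝ, 0 < δ ∧ ∀ ε : ℝ, 0 < ε → ε < ε₀ → ∀ A : X → ℝ,
        (∀ x ∈ D, |A x - α₀ x| < δ) → ∀ v ∈ N, ∃ x ∈ D, ∑ i, v i * Φ ε (A x) x i ≠ 0)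
      ⟨1, one_pos, 1, one_pos, fun _ _ _ _ _ v hv => hv.elim⟩ ?_ ?_ fun v hv => ?_
    · rintro s t hst ⟨ε₀, hε₀, δ, hδ, H⟩
      exact ⟨ε₀, hε₀, δ, hδ, fun ε h1 h2 A hA v hv => H ε h1 h2 A hA v (hst hv)⟩
    · rintro s t ⟨ε₀, hε₀, δ, hδ, H⟩ ⟨ε₁, hε₁, δ', hδ', H'⟩
      refine ⟨min ε₀ ε₁, lt_min hε₀ hε₁, min δ δ', lt_min hδ hδ', fun ε h1 h2 A hA v hv => ?_⟩
      rcases hv with hv | hv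
      · exact H ε h1 (h2.trans_le (min_le_left _ _)) A
          (fun x hx => (hA x hx).trans_le (min_le_left _ _)) v hv
      · exact H' ε h1 (h2.trans_le (min_le_right _ _)) A
          (fun x hx => (hA x hx).trans_le (min_le_right _ _)) v hv
    · obtain ⟨x, hx, hxv⟩ := hF₀ v (ne_zero_of_mem_unit_sphere ⟨v, hv⟩)
      have hlim : Tendsto (fun q : (ι → ℝ) × (ι → ℝ) => ∑ i, q.1 i * q.2 i)
          (𝓝 v ×ˢ 𝓝 (F₀ x)) (𝓝 (∑ i, v i * F₀ x i)) := by
        rw [← nhds_prod_eq]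
        exact (by fun_prop : Continuous fun q : (ι → ℝ) × (ι → ℝ) =>
          ∑ i, q.1 i * q.2 i).tendsto (v, F₀ x)
      have hev := (hlim.comp (tendsto_id.prodMap (hΦ x hx))).eventually_ne hxv
      obtain ⟨pN, hpN, pE, hpE, hNE⟩ := eventually_prod_iff.1 hev
      obtain ⟨pε, hpε, pα, hpα, hεα⟩ := eventually_prod_iff.1 hpE
      obtain ⟨ε₀, hε₀, hε⟩ := mem_nhdsGT_iff_exists_Ioo_subset.1 hpε
      obtain ⟨δ, hδ, hα⟩ := Metric.eventually_nhds_iff.1 hpα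
      refine ⟨{v | pN v}, mem_nhdsWithin_of_mem_nhds hpN, ε₀, hε₀, δ, hδ,
        fun ε h1 h2 A hA w hw => ⟨x, hx, ?_⟩⟩
      exact hNE hw (hεα (hε ⟨h1, h2⟩) (hα (by rw [Real.dist_eq]; exact hA x hx)))
  refine ⟨ε₀, hε₀, δ, hδ, fun ε h1 h2 A hA v hv => ?_⟩
  have hvpos : 0 < ‖v‖ := norm_pos_iff.2 hv
  obtain ⟨x, hx, hne⟩ := H ε h1 h2 A hA (‖v‖⁻¹ • v) (by
    rw [mem_sphere_zero_iff_norm, norm_smul, norm_inv, norm_norm, inv_mul_cancel₀ hvpos.ne'])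
  refine ⟨x, hx, fun h0 => hne ?_⟩
  simp only [Pi.smul_apply, smul_eq_mul, mul_assoc, ← Finset.mul_sum, h0, mul_zero]

end PNLS

theorem mainTheorem3 (D : Set (ℝ × ℝ)) (hDo : IsOpen D) (hDc : IsConnected D)
    (hDk : IsCompact (closure D)) (hDs : closure D ⊆ PNLS.baseRegion) :
    ∃ ε₀ : ℝ, 0 < ε₀ ∧ ∃ δ : ℝ, 0 < δ ∧
      ∀ ε : ℝ, 0 < ε → ε < ε₀ →
        ∀ E : Set (ℝ × ℝ × ℝ), PNLS.IsSilnikovSurface ε δ D E →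
          ∀ᵐ p ∂((Measure.hausdorffMeasure 2 : Measure (ℝ × ℝ × ℝ)).restrict E),
            PNLS.SiegelNonresonant ε p.1 p.2.1 p.2.2 := by
  have hDs' : D ⊆ PNLS.baseRegion := subset_closure.trans hDs
  obtain ⟨ε₀, hε₀, δ, hδ, H⟩ := PNLS.exists_independent_of_tendsto (D := D)
    (F₀ := fun x => PNLS.scaledBasis (1 / PNLS.kappa x.2) (x.2 ^ 2) x)
    (Φ := fun ε α x => PNLS.scaledBasis α (PNLS.saddleIntensity ε α x.1 x.2) x)
    (α₀ := fun x => 1 / PNLS.kappa x.2) (fun x hx => by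
      obtain ⟨hω, -, hκ, hβ⟩ := hDs' hx
      have hω0 : 0 < x.2 := by linarith
      have hJ := PNLS.tendsto_saddleIntensity (one_div_pos.2 hκ) (by rwa [one_div_mul_eq_div]) hω0
      have hpair := (tendsto_snd (f := 𝓝[>] (0 : ℝ)) (g := 𝓝 (1 / PNLS.kappa x.2))).prodMk_nhds hJ
      exact (PNLS.continuousAt_scaledBasis x (pow_pos hω0 2)).tendsto.comp hpair)
    (fun v hv => by
      by_contra! hall
      exact hv (PNLS.linearIndependent_scaledBasis hDo hDc.nonempty hDs' hall))
  refine ⟨ε₀, hε₀, δ, hδ, fun ε hε hεlt E hE => ?_⟩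
  obtain ⟨A, hA, hAδ, rfl⟩ := hE.surface
  have hreg : ∀ x ∈ D, 0 < A x ∧ 1 / 2 < x.2 ∧ x.2 < 1 := fun x hx => by
    obtain ⟨h1, -, h2, h3, -⟩ := hE.region (A x) x.1 x.2 ⟨x, hx, rfl⟩
    exact ⟨h1, h2, h3⟩
  have hS : ∀ x ∈ D, PNLS.IsSilnikovSaddle ε (A x) x.1 x.2 := fun x hx =>
    (hE.support (A x) x.1 x.2 ⟨x, hx, rfl⟩).1
  have hind : ∀ v : Fin 4 → ℝ, v ≠ 0 →
      ∃ x ∈ D, ∑ i, v i * PNLS.divisorBasis ε (A x) x.1 x.2 i ≠ 0 := by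
    intro v hv
    set c : Fin 4 → ℝ := ![ε, ε, 2 * √ε, 2] with hc
    have hc0 : ∀ i, c i ≠ 0 := by
      have := Real.sqrt_pos.2 hε
      intro i
      fin_cases i <;> simp only [hc, Fin.zero_eta, Fin.mk_one, Fin.reduceFinMk, Matrix.cons_val] <;>
        positivity
    obtain ⟨i, hi⟩ := Function.ne_iff.1 hv
    obtain ⟨x, hx, hne⟩ := H ε hε hεlt A hAδ (fun i => v i * c i)
      (Function.ne_iff.2 ⟨i, mul_ne_zero hi (hc0 i)⟩)
    refine ⟨x, hx, ?_⟩
    simpa only [(hS x hx).divisorBasis_eq hε, ← mul_assoc] using hne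
  have hdio := PNLS.ae_diophantine (volume : Measure (ℝ × ℝ)) hDo hDc.isPreconnected
    (F := fun i x => PNLS.divisorBasis ε (A x) x.1 x.2 i)
    (PNLS.analyticOnNhd_divisorBasis hε hDo hA (fun x hx => (hreg x hx).1) hS) hind
  refine PNLS.ae_hausdorffMeasure_restrict_graph hDo hA (hdio.mono fun x hx hxD => ?_)
  obtain ⟨C, hC, s, hCs⟩ := hx hxD
  obtain ⟨h1, h2, h3⟩ := hreg x hxD
  exact (hS x hxD).siegelNonresonant hε h1 h2 h3 hC hCs
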